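/- All graphs are finite, simple and undirected. A graph $G$ is planar-emulable if there are a finite planar graph $H$ and a graph homomorphism $\varphi$ of $H$ onto $G$ (so $\varphi: V(H)\to V(G)$ is surjective) such that, for every vertex $x\in V(H)$, the neighbours of $x$ in $H$ are mapped by $\varphi$ surjectively onto the neighbours of $\varphi(x)$ in $G$. A $Y\Delta$-transformation of a graph at a vertex $v$ of degree $3$ deletes $v$ and joins any two of its three neighbours by an edge (edges that are already present are kept as single edges). Proposition. If $G$ is planar-emulable and $G'$ is obtained from $G$ by successively applying finitely many $Y\Delta$-transformations, each at a vertex of degree $3$ of the current graph, then $G'$ is planar-emulable. -/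

import Mathlib

universe u

/-- The Euclidean plane. -/
abbrev Plane : Type := EuclideanSpace ℝ (Fin 2)

/-- `IsPolygonalArc p q A`: the point set `A` is a simple polygonal arc with end points `p` and `q`,
that is, a subset of the plane which is a union of finitely many straight line segments and is
homeomorphic to `[0, 1]`, built up segment by segment. -/
inductive IsPolygonalArc : Plane → Plane → Set Plane → Prop
  | single {p q : Plane} (hpq : p ≠ q) : IsPolygonalArc p q (segment ℝ p q)
  | cons {p q r : Plane} {A : Set Plane} (hpq : p ≠ q) (hA : IsPolygonalArc q r A)
      (hinter : segment ℝ p q ∩ A = {q}) : IsPolygonalArc p r (segment ℝ p q ∪ A)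

namespace SimpleGraph

/-- A drawing of the graph `H` in the plane without crossings: distinct vertices are distinct points,
every edge is an arc joining its two ends, an arc contains no vertex other than its ends, and two
distinct arcs have no common point other than a common end. -/
structure PlaneDrawing {W : Type u} (H : SimpleGraph W) where
  /-- the point representing a vertex -/
  pos : W → Plane
  /-- the point set representing an edge -/
  arc : Sym2 W → Set Plane
  pos_injective : Function.Injective pos
  isPolygonalArc : ∀ x y : W, H.Adj x y → IsPolygonalArc (pos x) (pos y) (arc s(x, y))
  vertex_mem_arc : ∀ e ∈ H.edgeSet, ∀ x : W, pos x ∈ arc e → x ∈ e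
  arc_inter_arc : ∀ e ∈ H.edgeSet, ∀ f ∈ H.edgeSet, e ≠ f →
    ∀ p ∈ arc e ∩ arc f, ∃ x : W, x ∈ e ∧ x ∈ f ∧ pos x = p

/-- A graph is planar if it has a drawing in the plane without crossings. -/
def IsPlanar {W : Type u} (H : SimpleGraph W) : Prop := Nonempty H.PlaneDrawing

/-- An emulator projection: a homomorphism of `H` onto `G` that maps, for every vertex `x` of `H`,
the neighbours of `x` surjectively onto the neighbours of the image of `x`. -/
def IsEmulatorProjection {W V : Type*} {H : SimpleGraph W} {G : SimpleGraph V} (φ : H →g G) : Prop :=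
  Function.Surjective φ ∧ ∀ x : W, φ '' H.neighborSet x = G.neighborSet (φ x)

/-- `G` is planar-emulable: there is a finite planar graph `H` with an emulator projection
to `G`. -/
def PlanarEmulable {V : Type*} (G : SimpleGraph V) : Prop :=
  ∃ (W : Type) (_ : Finite W) (H : SimpleGraph W),
    H.IsPlanar ∧ ∃ φ : H →g G, IsEmulatorProjection φ

/-- The graph obtained from `G` by deleting the vertex `v` and making any two distinct neighbours
of `v` adjacent (edges that are already there are kept as single edges). If `v` has degree three,
this is the YΔ-transformation of `G` at `v`. -/
def yDelta {V : Type*} (G : SimpleGraph V) (v : V) : SimpleGraph {w : V // w ≠ v} where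
  Adj a b := a ≠ b ∧ (G.Adj a b ∨ (G.Adj v a ∧ G.Adj v b))
  symm := ⟨fun _ _ h => ⟨h.1.symm, h.2.imp (fun h' => h'.symm) (fun h' => ⟨h'.2, h'.1⟩)⟩⟩
  loopless := ⟨fun _ h => h.1 rfl⟩

/-- `G.YDeltaReachable G'`: up to isomorphism, `G'` arises from `G` by successively applying finitely
many YΔ-transformations, each at a vertex that has degree three in the current graph. -/
inductive YDeltaReachable {V : Type u} (G : SimpleGraph V) : {W : Type u} → SimpleGraph W → Prop
  | refl : YDeltaReachable G G
  | step {W X : Type u} {G₁ : SimpleGraph W} {G₂ : SimpleGraph X} (h : YDeltaReachable G G₁)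
      (v : W) (hv : (G₁.neighborSet v).ncard = 3) (e : G₁.yDelta v ≃g G₂) : YDeltaReachable G G₂

end SimpleGraph

/-!
Let `v` be a vertex of degree three of `G` and let `H` be a planar emulator of `G` with projection
`φ`. Regard `φ` as a colouring of `H`. The idea is to remove every vertex `x` of `H` over `v` and to
fill the hole with chords between the former neighbours of `x`. These neighbours carry the three
colours of the neighbours of `v`, but each colour may occur several times, in any cyclic order.

*Combinatorics.* A convex polygon whose corners carry all of three colours has noncrossing chords
such that every monochromatic component is adjacent to both other colours
(`SimpleGraph.exists_noncrossing_chords`). One cuts off, one after the other, a corner whose colour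
occurs elsewhere and whose two neighbours are not of one and the same other colour; such a corner
exists as long as there are at least four corners (`SimpleGraph.exists_ear`). After the chords have
been inserted for all vertices over `v`, the monochromatic edges are contracted, and an emulator of
the transformed graph is left (`SimpleGraph.planarEmulable_of_seesColor`).

*Geometry.* Both the insertion of chords and the contraction of an edge follow from
`SimpleGraph.IsPlanar.exists_circle`: the neighbours of a vertex `x` can be placed on a circle so
that `x` may be replaced by any straight chords which do not cross each other. For the contraction
of `xy`, these chords form a fan from `y`. To place a neighbour `w` on a small circle around `x`, it
is moved along the arc from `w` to `x`, one segment after the other. Such a move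
(`SimpleGraph.PlaneDrawing.exists_move`) takes place in a thin lens around the segment that meets,
apart from the arc itself, only the initial segments of the other edges at `w`. Since the lens is
strictly convex, the parts of these edges in the lens can be replaced by chords from the new
position of `w`, and no crossings arise. The lens is bounded by two parabolas, so it is pointed at
the new position and avoids the continuation of the arc, whatever its direction.
-/

open Filter Topology

/-! ### Segments -/

namespace Plane

/-- Two segments from `q` that share a second point lie on the same ray. -/
theorem wbtw_or_wbtw_of_mem_segments {q z z' p : Plane} (hpq : p ≠ q) (hp : p ∈ segment ℝ q z)
    (hp' : p ∈ segment ℝ q z') : Wbtw ℝ q z z' ∨ Wbtw ℝ q z' z := by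
  obtain ⟨a, ⟨ha0, ha1⟩, rfl⟩ := mem_segment_iff_wbtw.1 hp
  obtain ⟨b, ⟨hb0, hb1⟩, hb⟩ := mem_segment_iff_wbtw.1 hp'
  simp only [AffineMap.lineMap_apply, vsub_eq_sub, vadd_eq_add] at hb hpq
  have ha : 0 < a := ha0.lt_of_ne (by rintro rfl; simp at hpq)
  have hb' : 0 < b := hb0.lt_of_ne (by
    rintro rfl
    exact hpq (by rw [← hb]; simp))
  have hb2 : b • (z' - q) = a • (z - q) := add_right_cancel hb
  rcases le_total a b with hab | hab
  · refine Or.inr ⟨a / b, ⟨by positivity, (div_le_one hb').2 hab⟩, ?_⟩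
    simp only [AffineMap.lineMap_apply, vsub_eq_sub, vadd_eq_add]
    rw [div_eq_inv_mul, mul_smul, ← hb2, smul_smul, inv_mul_cancel₀ hb'.ne', one_smul,
      sub_add_cancel]
  · refine Or.inl ⟨b / a, ⟨by positivity, (div_le_one ha).2 hab⟩, ?_⟩
    simp only [AffineMap.lineMap_apply, vsub_eq_sub, vadd_eq_add]
    rw [div_eq_inv_mul, mul_smul, hb2, smul_smul, inv_mul_cancel₀ ha.ne', one_smul,
      sub_add_cancel]

theorem segment_eq_union {w q o : Plane} (hq : q ∈ segment ℝ w o) :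
    segment ℝ w o = segment ℝ w q ∪ segment ℝ q o := by
  apply Set.Subset.antisymm
  · intro p hp
    obtain ⟨s, ⟨hs0, hs1⟩, rfl⟩ := mem_segment_iff_wbtw.1 hq
    obtain ⟨t, ⟨ht0, ht1⟩, rfl⟩ := mem_segment_iff_wbtw.1 hp
    rcases le_total t s with h | h
    · left
      have : Wbtw ℝ 0 t s := mem_segment_iff_wbtw.1 (by rw [segment_eq_Icc hs0]; exact ⟨ht0, h⟩)
      simpa using mem_segment_iff_wbtw.2 (this.map (AffineMap.lineMap w o))
    · right
      have : Wbtw ℝ s t 1 := mem_segment_iff_wbtw.1 (by rw [segment_eq_Icc hs1]; exact ⟨h, ht1⟩)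
      simpa using mem_segment_iff_wbtw.2 (this.map (AffineMap.lineMap w o))
  · exact Set.union_subset
      ((convex_segment _ _).segment_subset (left_mem_segment ℝ _ _) hq)
      ((convex_segment _ _).segment_subset hq (right_mem_segment ℝ _ _))

theorem segment_inter_segment {w q o : Plane} (hq : q ∈ segment ℝ w o) :
    segment ℝ w q ∩ segment ℝ q o = {q} := by
  apply Set.Subset.antisymm
  · rintro p ⟨hp, hp'⟩
    rw [mem_segment_iff_wbtw] at hq hp hp'
    exact (wbtw_swap_left_iff ℝ o).1 ⟨hq.trans_left_right hp, hp'⟩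
  · rintro _ rfl
    exact ⟨right_mem_segment ℝ _ _, left_mem_segment ℝ _ _⟩

end Plane

/-! ### Polygonal arcs -/

namespace IsPolygonalArc

theorem left_mem {p q : Plane} {A : Set Plane} (h : IsPolygonalArc p q A) : p ∈ A := by
  cases h with
  | single _ => exact left_mem_segment ℝ p q
  | cons _ _ _ => exact Or.inl (left_mem_segment ℝ _ _)

theorem right_mem {p q : Plane} {A : Set Plane} (h : IsPolygonalArc p q A) : q ∈ A := by
  induction h with
  | single _ => exact right_mem_segment ℝ _ _
  | cons _ _ _ ih => exact Or.inr ih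

theorem ne {p q : Plane} {A : Set Plane} (h : IsPolygonalArc p q A) : p ≠ q := by
  cases h with
  | single h => exact h
  | cons hpq hA hi =>
    rintro rfl
    exact hpq (hi.subset ⟨left_mem_segment ℝ _ _, hA.right_mem⟩)

theorem isCompact_segment (p q : Plane) : IsCompact (segment ℝ p q) := by
  rw [segment_eq_image_lineMap]
  exact isCompact_Icc.image AffineMap.lineMap_continuous

theorem isCompact {p q : Plane} {A : Set Plane} (h : IsPolygonalArc p q A) : IsCompact A := by
  induction h with
  | single _ => exact isCompact_segment _ _
  | cons _ _ _ ih => exact (isCompact_segment _ _).union ih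

theorem append {p q r : Plane} {A B : Set Plane} (hA : IsPolygonalArc p q A)
    (hB : IsPolygonalArc q r B) (hAB : A ∩ B ⊆ {q}) : IsPolygonalArc p r (A ∪ B) := by
  induction hA with
  | single hpq =>
    exact cons hpq hB (hAB.antisymm (by
      rintro _ rfl; exact ⟨right_mem_segment ℝ _ _, hB.left_mem⟩))
  | cons hpq hA hi ih =>
    rw [Set.union_assoc]
    refine cons hpq (ih hB fun y hy => hAB ⟨Or.inr hy.1, hy.2⟩) ?_
    apply Set.Subset.antisymm
    · rintro y ⟨hy, hy' | hy'⟩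
      · rw [← hi]; exact ⟨hy, hy'⟩
      · have := hAB ⟨Or.inl hy, hy'⟩
        rw [Set.mem_singleton_iff] at this
        subst this
        rw [← hi]; exact ⟨hy, hA.right_mem⟩
    · rintro _ rfl
      exact ⟨right_mem_segment ℝ _ _, Or.inl hA.left_mem⟩

theorem symm {p q : Plane} {A : Set Plane} (h : IsPolygonalArc p q A) :
    IsPolygonalArc q p A := by
  induction h with
  | single h => rw [segment_symm]; exact single h.symm
  | @cons p q r A hpq hA hi ih =>
    rw [Set.union_comm]
    refine append ih (by rw [segment_symm]; exact single hpq.symm) ?_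
    rw [Set.inter_comm, hi]

/-- A polygonal arc starts with a segment, which may be shortened from its initial end. -/
theorem exists_initial_segment {p q : Plane} {A : Set Plane} (h : IsPolygonalArc p q A) :
    ∃ (y : Plane) (R : Set Plane), p ≠ y ∧ IsCompact R ∧ segment ℝ p y ∩ R = {y} ∧
      A = segment ℝ p y ∪ R ∧
      ∀ z ∈ segment ℝ p y, z ≠ y → IsPolygonalArc z q (segment ℝ z y ∪ R) := by
  cases h with
  | single h =>
    refine ⟨q, {q}, h, isCompact_singleton, ?_, ?_, ?_⟩
    · exact Set.inter_eq_right.2 (by simpa using right_mem_segment ℝ p q)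
    · exact (Set.union_eq_left.2 (by simpa using right_mem_segment ℝ p q)).symm
    · intro z hz hzq
      rw [Set.union_eq_left.2 (by simpa using right_mem_segment ℝ z q)]
      exact single hzq
  | @cons _ y _ R hpq hA hi =>
    refine ⟨y, R, hpq, hA.isCompact, hi, rfl, fun z hz hzy => cons hzy hA ?_⟩
    apply Set.Subset.antisymm
    · rw [← hi]
      exact Set.inter_subset_inter_left _
        ((convex_segment p y).segment_subset hz (right_mem_segment ℝ _ _))
    · rintro _ rfl
      exact ⟨right_mem_segment ℝ _ _, hA.left_mem⟩

end IsPolygonalArc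

/-! ### Thin lenses around a segment -/

namespace PlaneLens

/-- The coordinate of `y` along the axis from `q` to `w`: it is `0` at `q` and `1` at `w`. -/
noncomputable def axial (w q y : Plane) : ℝ :=
  ((y 0 - q 0) * (w 0 - q 0) + (y 1 - q 1) * (w 1 - q 1)) /
    ((w 0 - q 0) ^ 2 + (w 1 - q 1) ^ 2)

/-- The coordinate of `y` perpendicular to the axis from `q` to `w`. -/
noncomputable def lateral (w q y : Plane) : ℝ :=
  ((y 1 - q 1) * (w 0 - q 0) - (y 0 - q 0) * (w 1 - q 1)) /
    ((w 0 - q 0) ^ 2 + (w 1 - q 1) ^ 2)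

/-- The function whose sublevel set `{y | lensGauge w q ε y ≤ 0}` is a thin lens, bounded by two
parabolas: one of its tips is `q`, the other one lies slightly beyond `w`. -/
noncomputable def lensGauge (w q : Plane) (ε : ℝ) (y : Plane) : ℝ :=
  |lateral w q y| - ε * (axial w q y * (1 + ε - axial w q y))

variable {w q : Plane}

theorem normSq_pos (h : w ≠ q) : 0 < (w 0 - q 0) ^ 2 + (w 1 - q 1) ^ 2 := by
  by_contra hn
  apply h
  have h0 : (w 0 - q 0) = 0 := by nlinarith [sq_nonneg (w 0 - q 0), sq_nonneg (w 1 - q 1)]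
  have h1 : (w 1 - q 1) = 0 := by nlinarith [sq_nonneg (w 0 - q 0), sq_nonneg (w 1 - q 1)]
  ext i
  fin_cases i
  · simpa using sub_eq_zero.1 h0
  · simpa using sub_eq_zero.1 h1

theorem continuous_axial : Continuous (axial w q) := by unfold axial; fun_prop

theorem continuous_lateral : Continuous (lateral w q) := by unfold lateral; fun_prop

theorem continuous_lensGauge (ε : ℝ) : Continuous (lensGauge w q ε) := by
  have := @continuous_axial w q
  have := @continuous_lateral w q
  unfold lensGauge; fun_prop

theorem axial_comb (y z : Plane) {a b : ℝ} (hab : a + b = 1) :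
    axial w q (a • y + b • z) = a * axial w q y + b * axial w q z := by
  obtain rfl : b = 1 - a := by linarith
  simp only [axial, PiLp.add_apply, PiLp.smul_apply, smul_eq_mul]
  ring

theorem lateral_comb (y z : Plane) {a b : ℝ} (hab : a + b = 1) :
    lateral w q (a • y + b • z) = a * lateral w q y + b * lateral w q z := by
  obtain rfl : b = 1 - a := by linarith
  simp only [lateral, PiLp.add_apply, PiLp.smul_apply, smul_eq_mul]
  ring

@[simp] theorem axial_base : axial w q q = 0 := by simp [axial]

@[simp] theorem lateral_base : lateral w q q = 0 := by simp [lateral]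

theorem axial_top (h : w ≠ q) : axial w q w = 1 := by
  have := normSq_pos h
  rw [axial, div_eq_one_iff_eq this.ne']; ring

@[simp] theorem lateral_top : lateral w q w = 0 := by
  rw [lateral, mul_comm, sub_self, zero_div]

@[simp] theorem lensGauge_base (ε : ℝ) : lensGauge w q ε q = 0 := by simp [lensGauge]

theorem lensGauge_top (h : w ≠ q) {ε : ℝ} (hε : 0 < ε) : lensGauge w q ε w < 0 := by
  simp only [lensGauge, axial_top h, lateral_top, abs_zero]
  nlinarith

theorem eq_comb (h : w ≠ q) {y : Plane} (hy : lateral w q y = 0) :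
    y = (1 - axial w q y) • q + axial w q y • w := by
  have hN := normSq_pos h
  rw [lateral, div_eq_zero_iff, or_iff_left hN.ne'] at hy
  ext i
  fin_cases i
  · simp only [axial, Fin.zero_eta, PiLp.add_apply, PiLp.smul_apply, smul_eq_mul]
    field_simp
    linear_combination (-(w 1 - q 1)) * hy
  · simp only [axial, Fin.mk_one, PiLp.add_apply, PiLp.smul_apply, smul_eq_mul]
    field_simp
    linear_combination (w 0 - q 0) * hy

theorem eq_of_coords (h : w ≠ q) {y z : Plane} (ha : axial w q y = axial w q z)
    (hl : lateral w q y = lateral w q z) : y = z := by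
  have hN := normSq_pos h
  rw [axial, axial, div_left_inj' hN.ne'] at ha
  rw [lateral, lateral, div_left_inj' hN.ne'] at hl
  ext i
  fin_cases i
  · apply mul_right_cancel₀ hN.ne'
    simp only [Fin.zero_eta]
    linear_combination (w 0 - q 0) * ha - (w 1 - q 1) * hl
  · apply mul_right_cancel₀ hN.ne'
    simp only [Fin.mk_one]
    linear_combination (w 1 - q 1) * ha + (w 0 - q 0) * hl

theorem mem_segment_of_coords (h : w ≠ q) {y : Plane} (hl : lateral w q y = 0)
    (h0 : 0 ≤ axial w q y) (h1 : axial w q y ≤ 1) : y ∈ segment ℝ w q :=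
  ⟨axial w q y, 1 - axial w q y, h0, by linarith, by ring, by
    conv_rhs => rw [eq_comb h hl]
    rw [add_comm]⟩

/-- The lens is strictly convex. -/
theorem lensGauge_neg_of_mem_openSegment (h : w ≠ q) {ε : ℝ} (hε : 0 < ε) {y z m : Plane}
    (hyz : y ≠ z) (hy : lensGauge w q ε y ≤ 0) (hz : lensGauge w q ε z ≤ 0)
    (hm : m ∈ openSegment ℝ y z) : lensGauge w q ε m < 0 := by
  obtain ⟨a, b, ha, hb, hab, rfl⟩ := hm
  simp only [lensGauge, axial_comb y z hab, lateral_comb y z hab] at *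
  by_cases hs : axial w q y = axial w q z
  · have hl : lateral w q y ≠ lateral w q z := fun hl => hyz (eq_of_coords h hs hl)
    rw [← hs] at hz ⊢
    obtain rfl : b = 1 - a := by linarith
    have e : a * axial w q y + (1 - a) * axial w q y = axial w q y := by ring
    rw [e]
    generalize ε * (axial w q y * (1 + ε - axial w q y)) = C at *
    obtain ⟨h1, h2⟩ := abs_le.1 (sub_nonpos.1 hy)
    obtain ⟨h3, h4⟩ := abs_le.1 (sub_nonpos.1 hz)
    rw [sub_neg, abs_lt]
    rcases lt_or_gt_of_ne hl with hl | hl <;> constructor <;> nlinarith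
  · have h2 : 0 < a * b * (axial w q y - axial w q z) ^ 2 := by
      have := sub_ne_zero.2 hs
      positivity
    have h3 : |a * lateral w q y + b * lateral w q z| ≤
        a * |lateral w q y| + b * |lateral w q z| := by
      refine (abs_add_le _ _).trans ?_
      rw [abs_mul, abs_mul, abs_of_pos ha, abs_of_pos hb]
    obtain rfl : b = 1 - a := by linarith
    have := mul_pos hε h2
    nlinarith [mul_le_mul_of_nonneg_left hy ha.le, mul_le_mul_of_nonneg_left hz hb.le]

theorem axial_mem_of_lensGauge_nonpos {ε : ℝ} (hε : 0 < ε) {y : Plane} (hy : lensGauge w q ε y ≤ 0) :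
    0 ≤ axial w q y ∧ axial w q y ≤ 1 + ε := by
  have h0 : 0 ≤ axial w q y * (1 + ε - axial w q y) := by
    have := abs_nonneg (lateral w q y)
    unfold lensGauge at hy
    by_contra hn
    nlinarith [mul_pos hε (neg_pos.2 (not_le.1 hn))]
  constructor <;> nlinarith

/-- The lens touches the line through its tip `q` perpendicular to its axis only at `q`. -/
theorem eq_or_axial_pos (h : w ≠ q) {ε : ℝ} (hε : 0 < ε) {y : Plane} (hy : lensGauge w q ε y ≤ 0) :
    y = q ∨ 0 < axial w q y := by
  rcases (axial_mem_of_lensGauge_nonpos hε hy).1.eq_or_lt with h0 | h0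
  · left
    refine eq_of_coords h (by simp [← h0]) ?_
    rw [lensGauge, ← h0] at hy
    simpa using hy
  · exact Or.inr h0

/-- Thin lenses avoid a given compact set disjoint from the axis. -/
theorem eventually_disjoint (h : w ≠ q) {K : Set Plane} (hK : IsCompact K)
    (hd : ∀ y ∈ K, y ∉ segment ℝ w q) :
    ∀ᶠ ε in 𝓝[>] (0 : ℝ), ∀ y ∈ K, 0 < lensGauge w q ε y := by
  rcases K.eq_empty_or_nonempty with rfl | hne
  · simp
  set F : Plane → ℝ := fun y => max |lateral w q y| (max (-axial w q y) (axial w q y - 1)) with hF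
  have hc : Continuous F := by
    have := @continuous_axial w q
    have := @continuous_lateral w q
    fun_prop
  obtain ⟨y₀, hy₀, hmin⟩ := hK.exists_isMinOn hne hc.continuousOn
  have hpos : 0 < F y₀ := by
    by_contra hn
    simp only [hF, not_lt, max_le_iff] at hn
    obtain ⟨h1, h2, h3⟩ := hn
    exact hd y₀ hy₀ (mem_segment_of_coords h (abs_nonpos_iff.1 h1) (by linarith) (by linarith))
  have h1 : ∀ᶠ ε in 𝓝[>] (0 : ℝ), ε < min (F y₀ / 2) 1 :=
    nhdsWithin_le_nhds (eventually_lt_nhds (by positivity))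
  filter_upwards [h1, self_mem_nhdsWithin] with ε h1 hε y hy
  have hε' : 0 < ε := hε
  rw [lt_min_iff] at h1
  by_contra hn
  have hn' := not_lt.1 hn
  obtain ⟨h2, h3⟩ := axial_mem_of_lensGauge_nonpos hε' hn'
  have h4 : F y₀ ≤ F y := hmin hy
  have h5 : F y < F y₀ := by
    simp only [hF, max_lt_iff] at h4 ⊢
    refine ⟨?_, ?_, ?_⟩
    · unfold lensGauge at hn'
      have : axial w q y * (1 + ε - axial w q y) ≤ 1 := by
        nlinarith [sq_nonneg (axial w q y - (1 + ε) / 2)]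
      have h6 := mul_le_mul_of_nonneg_left this hε'.le
      change _ < F y₀
      linarith [h1.1]
    · change _ < F y₀
      linarith
    · change _ < F y₀
      linarith [h1.1]
  linarith

/-- Thin lenses meet a given segment that leaves the tip `q` off the axis only in `q`. -/
theorem eventually_segment (h : w ≠ q) {y : Plane} (hy : segment ℝ w q ∩ segment ℝ q y ⊆ {q}) :
    ∀ᶠ ε in 𝓝[>] (0 : ℝ), ∀ z ∈ segment ℝ q y, z ≠ q → 0 < lensGauge w q ε z := by
  by_cases hl : lateral w q y = 0
  · have hs : axial w q y ≤ 0 := by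
      by_contra hs
      rw [not_le] at hs
      by_cases hyq : y = q
      · simp [hyq] at hs
      -- the point of the segment with a small positive axial coordinate lies on the axis
      set a : ℝ := 1 / (1 + axial w q y)
      have ha : 0 < a := by positivity
      have ha1 : a ≤ 1 := by
        rw [div_le_one (by positivity)]; linarith
      have has : a * axial w q y ≤ 1 := by
        rw [one_div_mul_eq_div, div_le_one (by positivity)]; linarith
      have key : (1 - a) • q + a • y ∈ ({q} : Set Plane) := by
        refine hy ⟨mem_segment_of_coords h ?_ ?_ ?_, ⟨1 - a, a, by linarith, ha.le, by ring, rfl⟩⟩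
        · rw [lateral_comb _ _ (by ring)]; simp [hl]
        · rw [axial_comb _ _ (by ring)]; simp; positivity
        · rw [axial_comb _ _ (by ring)]; simpa using has
      rw [Set.mem_singleton_iff] at key
      have := congrArg (axial w q) key
      rw [axial_comb _ _ (by ring)] at this
      simp at this
      rcases this with h' | h' <;> linarith
    filter_upwards [self_mem_nhdsWithin] with ε hε z hz hzq
    by_contra hn
    rcases eq_or_axial_pos h hε (not_lt.1 hn) with h1 | h1
    · exact hzq h1
    · obtain ⟨a, b, ha, hb, hab, rfl⟩ := hz
      rw [axial_comb _ _ hab] at h1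
      simp at h1
      nlinarith
  · have h0 : 0 < |lateral w q y| := abs_pos.2 hl
    have h1 : ∀ᶠ ε in 𝓝[>] (0 : ℝ), ε < min (|lateral w q y| / (2 * (|axial w q y| + 1))) 1 :=
      nhdsWithin_le_nhds (eventually_lt_nhds (by positivity))
    filter_upwards [h1, self_mem_nhdsWithin] with ε h1 hε z hz hzq
    have hε' : 0 < ε := hε
    rw [lt_min_iff, lt_div_iff₀ (by positivity)] at h1
    obtain ⟨a, b, ha, hb, hab, rfl⟩ := hz
    have hb' : 0 < b := by
      refine hb.lt_of_ne ?_
      rintro rfl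
      apply hzq
      obtain rfl : a = 1 := by linarith
      simp
    simp only [lensGauge, axial_comb _ _ hab, lateral_comb _ _ hab, axial_base, lateral_base, mul_zero,
      zero_add, abs_mul, abs_of_pos hb']
    have h2 := le_abs_self (axial w q y)
    have h3 : b * axial w q y * (1 + ε - b * axial w q y) ≤ b * (2 * |axial w q y|) := by
      have : b * axial w q y * (1 + ε) ≤ b * (2 * |axial w q y|) := by
        rw [mul_assoc]
        refine mul_le_mul_of_nonneg_left ?_ hb
        nlinarith [abs_nonneg (axial w q y)]
      nlinarith [sq_nonneg (b * axial w q y)]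
    nlinarith [mul_le_mul_of_nonneg_left h3 hε'.le, mul_pos hb' h0]

/-- A segment that starts in `w` and leaves the lens does so in a single boundary point `z`. -/
theorem exists_mem_segment_lensGauge_eq_zero {w q y : Plane} (hwq : w ≠ q) {ε : ℝ} (hε : 0 < ε)
    (hy : 0 < lensGauge w q ε y) :
    ∃ z ∈ segment ℝ w y, lensGauge w q ε z = 0 ∧
      ∀ p ∈ segment ℝ z y, lensGauge w q ε p ≤ 0 → p = z := by
  have hw := lensGauge_top hwq hε
  have hpre : IsPreconnected (segment ℝ w y) := (convex_segment w y).isPreconnected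
  obtain ⟨z, hz, hz0⟩ := hpre.intermediate_value (left_mem_segment ℝ w y)
    (right_mem_segment ℝ w y) (continuous_lensGauge (w := w) (q := q) ε).continuousOn ⟨hw.le, hy.le⟩
  refine ⟨z, hz, hz0, fun p hp hp0 => ?_⟩
  by_contra hpz
  have hwz : w ≠ z := by rintro rfl; exact hw.ne hz0
  have hwp : w ≠ p := by
    rintro rfl
    -- then `w` and `z` lie between each other on the segment to `y`
    have h1 := mem_segment_iff_wbtw.1 hz
    have h2 := mem_segment_iff_wbtw.1 hp
    exact hwz ((wbtw_swap_left_iff ℝ y).1 ⟨h1, h2⟩)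
  have hzo : z ∈ openSegment ℝ w p := by
    have h1 := mem_segment_iff_wbtw.1 hz
    have h2 := mem_segment_iff_wbtw.1 hp
    exact mem_openSegment_of_ne_left_right hwz hpz
      (mem_segment_iff_wbtw.2 (h1.trans_right_left h2))
  exact (lensGauge_neg_of_mem_openSegment hwq hε hwp hw.le hp0 hzo).ne hz0

/-- Chords of the lens from `q` to different boundary points meet in `q` only. -/
theorem chord_inter_chord {w q z z' p : Plane} (hwq : w ≠ q) {ε : ℝ} (hε : 0 < ε)
    (hz : lensGauge w q ε z = 0) (hz' : lensGauge w q ε z' = 0) (hne : z ≠ z')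
    (hzq : z ≠ q) (hzq' : z' ≠ q)
    (hp : p ∈ segment ℝ q z) (hp' : p ∈ segment ℝ q z') : p = q := by
  by_contra hpq
  have aux : ∀ u v : Plane, lensGauge w q ε u = 0 → lensGauge w q ε v = 0 → u ≠ q → v ≠ q → u ≠ v →
      Wbtw ℝ q u v → False := by
    intro u v hu hv huq hvq huv h
    have := mem_openSegment_of_ne_left_right huq.symm huv.symm (mem_segment_iff_wbtw.2 h)
    exact (lensGauge_neg_of_mem_openSegment hwq hε hvq.symm (lensGauge_base ε).le hv.le this).ne hu
  exact (Plane.wbtw_or_wbtw_of_mem_segments hpq hp hp').elim (aux z z' hz hz' hzq hzq' hne)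
    (aux z' z hz' hz hzq' hzq hne.symm)

theorem axial_pos_iff_inner_pos {w q y : Plane} (h : w ≠ q) :
    0 < axial w q y ↔ 0 < inner ℝ (y - q) (w - q) := by
  rw [axial, div_pos_iff_of_pos_right (normSq_pos h)]
  simp [PiLp.inner_apply, Fin.sum_univ_two, mul_comm]

end PlaneLens

/-! ### Moving a vertex along an edge -/

namespace SimpleGraph.PlaneDrawing

open PlaneLens

variable {W : Type*} {H : SimpleGraph W}

theorem eq_of_mem_edges {w u : W} {e f : Sym2 W} (hef : e ≠ f) (hwe : w ∈ e) (hwf : w ∈ f)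
    (hue : u ∈ e) (huf : u ∈ f) : u = w := by
  by_contra h
  exact hef (((Sym2.mem_and_mem_iff h).1 ⟨hue, hwe⟩).trans
    ((Sym2.mem_and_mem_iff h).1 ⟨huf, hwf⟩).symm)

/-- Two edges at `w` have only the point of `w` in common. -/
theorem eq_pos_of_mem_arcs (P : H.PlaneDrawing) {w : W} {e f : Sym2 W} (he : e ∈ H.edgeSet)
    (hf : f ∈ H.edgeSet) (hef : e ≠ f) (hwe : w ∈ e) (hwf : w ∈ f) {p : Plane} (hpe : p ∈ P.arc e)
    (hpf : p ∈ P.arc f) : p = P.pos w := by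
  obtain ⟨u, hue, huf, rfl⟩ := P.arc_inter_arc e he f hf hef p ⟨hpe, hpf⟩
  rw [eq_of_mem_edges hef hwe hwf hue huf]

theorem isCompact_arc (P : H.PlaneDrawing) {e : Sym2 W} (he : e ∈ H.edgeSet) :
    IsCompact (P.arc e) := by
  induction e with
  | _ x y => exact (P.isPolygonalArc x y he).isCompact

/-- If the arc of the edge `wx` starts with a segment from `w` to `q`, then the vertex `w` can be
moved along this segment to `q`. The other edges at `w` leave a thin lens around the segment at
distinct points of its boundary, and their parts in the lens are replaced by chords from `q`. -/
theorem exists_move [Finite W] (P : H.PlaneDrawing) {w x : W} (hwx : H.Adj w x) {q : Plane}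
    {A : Set Plane} (hwq : P.pos w ≠ q) (hA : IsPolygonalArc q (P.pos x) A)
    (hi : segment ℝ (P.pos w) q ∩ A = {q})
    (harc : P.arc s(w, x) = segment ℝ (P.pos w) q ∪ A) :
    ∃ P' : H.PlaneDrawing, P'.pos w = q ∧ (∀ y, y ≠ w → P'.pos y = P.pos y) ∧
      P'.arc s(w, x) = A ∧ (∀ e, w ∉ e → P'.arc e = P.arc e) ∧
      ∀ e ∈ H.edgeSet,
        P'.arc e ⊆ P.arc e ∪ {y | y = q ∨ 0 < axial (P.pos w) q y} := by
  classical
  set e₀ : Sym2 W := s(w, x) with he₀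
  have he₀E : e₀ ∈ H.edgeSet := hwx
  have hwe₀ : w ∈ e₀ := Sym2.mem_mk_left w x
  have hAe₀ : A ⊆ P.arc e₀ := by rw [harc]; exact Set.subset_union_right
  have hse₀ : segment ℝ (P.pos w) q ⊆ P.arc e₀ := by rw [harc]; exact Set.subset_union_left
  have hq₀ : q ∈ P.arc e₀ := hAe₀ hA.left_mem
  have hqA : ∀ {y}, y ∈ segment ℝ (P.pos w) q → y ∈ A → y = q := fun h1 h2 =>
    hi.subset ⟨h1, h2⟩
  have hqpos : ∀ y, P.pos y ≠ q := by
    intro y hy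
    have := P.vertex_mem_arc e₀ he₀E y (by rw [hy]; exact hq₀)
    rcases Sym2.mem_iff.1 this with rfl | rfl
    · exact hwq hy
    · exact hA.ne hy.symm
  -- the initial segments `[w, Y e]` of the other edges at `w`, and the remainders `R e`
  have hinit : ∀ e : Sym2 W, ∃ (y : Plane) (R : Set Plane), e ∈ H.edgeSet → w ∈ e → e ≠ e₀ →
      P.pos w ≠ y ∧ IsCompact R ∧ segment ℝ (P.pos w) y ∩ R = {y} ∧
      P.arc e = segment ℝ (P.pos w) y ∪ R ∧
      ∀ u, e = s(w, u) → ∀ z ∈ segment ℝ (P.pos w) y, z ≠ y →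
        IsPolygonalArc z (P.pos u) (segment ℝ z y ∪ R) := by
    intro e
    by_cases h : e ∈ H.edgeSet ∧ w ∈ e
    · obtain ⟨he, u, rfl⟩ := h
      obtain ⟨y, R, h1, h2, h3, h4, h5⟩ := (P.isPolygonalArc w u he).exists_initial_segment
      refine ⟨y, R, fun _ _ _ => ⟨h1, h2, h3, h4, fun u' hu' => ?_⟩⟩
      rwa [← Sym2.congr_right.1 hu']
    · exact ⟨q, ∅, fun h1 h2 => absurd ⟨h1, h2⟩ h⟩
  choose Y R hYR using hinit
  -- the choice of a thin lens
  have E1 : ∀ᶠ ε in 𝓝[>] (0 : ℝ), ∀ e, e ∈ H.edgeSet → w ∉ e →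
      ∀ y ∈ P.arc e, 0 < lensGauge (P.pos w) q ε y := by
    refine eventually_all.2 fun e => ?_
    by_cases h : e ∈ H.edgeSet ∧ w ∉ e
    · refine (eventually_disjoint hwq (P.isCompact_arc h.1) fun y hy hy' => ?_).mono
        fun ε hε _ _ => hε
      obtain ⟨u, hue, hue₀, rfl⟩ := P.arc_inter_arc e h.1 e₀ he₀E
        (by rintro rfl; exact h.2 hwe₀) y ⟨hy, hse₀ hy'⟩
      rcases Sym2.mem_iff.1 hue₀ with rfl | rfl
      · exact h.2 hue
      · exact hqpos u (hqA hy' hA.right_mem)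
    · exact Eventually.of_forall fun ε h1 h2 => absurd ⟨h1, h2⟩ h
  have E2 : ∀ᶠ ε in 𝓝[>] (0 : ℝ), ∀ y, y ≠ w → 0 < lensGauge (P.pos w) q ε (P.pos y) := by
    refine eventually_all.2 fun y => ?_
    by_cases hy : y = w
    · exact Eventually.of_forall fun ε h => absurd hy h
    · refine (eventually_disjoint hwq (isCompact_singleton (x := P.pos y)) ?_).mono
        fun ε hε _ => hε _ rfl
      rintro _ rfl hy'
      rcases Sym2.mem_iff.1 (P.vertex_mem_arc e₀ he₀E y (hse₀ hy')) with rfl | rfl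
      · exact hy rfl
      · exact hqpos y (hqA hy' hA.right_mem)
  have E3 : ∀ᶠ ε in 𝓝[>] (0 : ℝ), ∀ y ∈ A, y ≠ q → 0 < lensGauge (P.pos w) q ε y := by
    obtain ⟨y, R, h1, h2, h3, h4, -⟩ := hA.exists_initial_segment
    have a1 := eventually_segment (w := P.pos w) (q := q) (y := y) hwq (by
      rw [← hi, h4]
      exact Set.inter_subset_inter_right _ Set.subset_union_left)
    have a2 := eventually_disjoint hwq h2 (fun p hp hp' => by
      obtain rfl := hqA hp' (by rw [h4]; exact Or.inr hp)
      exact h1 (h3.subset ⟨left_mem_segment ℝ _ _, hp⟩))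
    filter_upwards [a1, a2] with ε a1 a2 p hp hpq
    rw [h4] at hp
    exact hp.elim (fun h => a1 p h hpq) (fun h => a2 p h)
  have E4 : ∀ᶠ ε in 𝓝[>] (0 : ℝ), ∀ e, e ∈ H.edgeSet ∧ w ∈ e ∧ e ≠ e₀ →
      ∀ y ∈ R e, 0 < lensGauge (P.pos w) q ε y := by
    refine eventually_all.2 fun e => ?_
    by_cases h : e ∈ H.edgeSet ∧ w ∈ e ∧ e ≠ e₀
    · obtain ⟨h1, h2, h3, h4, -⟩ := hYR e h.1 h.2.1 h.2.2
      refine (eventually_disjoint hwq h2 fun y hy hy' => ?_).mono fun ε hε _ => hε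
      obtain rfl := P.eq_pos_of_mem_arcs h.1 he₀E h.2.2 h.2.1 hwe₀
        (by rw [h4]; exact Or.inr hy) (hse₀ hy')
      exact h1 (h3.subset ⟨left_mem_segment ℝ _ _, hy⟩)
    · exact Eventually.of_forall fun ε h1 => absurd h1 h
  obtain ⟨ε, F1, F2, F3, F4, hε⟩ := (E1.and (E2.and (E3.and (E4.and self_mem_nhdsWithin)))).exists
  replace hε : 0 < ε := hε
  set g := lensGauge (P.pos w) q ε with hg
  have hgq : g q = 0 := lensGauge_base ε
  have hgw : g (P.pos w) < 0 := lensGauge_top hwq hε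
  -- the points where the other edges at `w` leave the lens, and the parts outside
  have hexit : ∀ e : Sym2 W, ∃ (z : Plane) (B : Set Plane), e ∈ H.edgeSet ∧ w ∈ e ∧ e ≠ e₀ →
      g z = 0 ∧ z ∈ B ∧ B ⊆ P.arc e ∧ (∀ y ∈ B, g y ≤ 0 → y = z) ∧
      ∀ u, e = s(w, u) → IsPolygonalArc z (P.pos u) B := by
    intro e
    by_cases h : e ∈ H.edgeSet ∧ w ∈ e ∧ e ≠ e₀
    · obtain ⟨h1, h2, h3, h4, h5⟩ := hYR e h.1 h.2.1 h.2.2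
      have hyR : Y e ∈ R e := (h3.symm.subset rfl).2
      obtain ⟨z, hz, hz0, hz'⟩ := exists_mem_segment_lensGauge_eq_zero hwq hε (F4 e h _ hyR)
      refine ⟨z, segment ℝ z (Y e) ∪ R e, fun _ => ⟨hz0, Or.inl (left_mem_segment ℝ _ _), ?_, ?_,
        fun u hu => h5 u hu z hz ?_⟩⟩
      · rw [h4]
        exact Set.union_subset_union_left _
          ((convex_segment _ _).segment_subset hz (right_mem_segment ℝ _ _))
      · rintro y (hy | hy) hy0
        · exact hz' y hy hy0
        · exact absurd hy0 (F4 e h y hy).not_ge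
      · rintro rfl
        exact (F4 e h _ hyR).ne' hz0
    · exact ⟨q, ∅, fun h1 => absurd h1 h⟩
  choose Z B hZB using hexit
  have hZq : ∀ e, e ∈ H.edgeSet ∧ w ∈ e ∧ e ≠ e₀ → Z e ≠ q := by
    intro e h hq
    obtain ⟨h1, h2, h3, -⟩ := hZB e h
    exact hwq (P.eq_pos_of_mem_arcs h.1 he₀E h.2.2 h.2.1 hwe₀ (h3 h2) (by rw [hq]; exact hq₀)
      |>.symm.trans hq)
  have hchord : ∀ e, e ∈ H.edgeSet ∧ w ∈ e ∧ e ≠ e₀ → ∀ y ∈ segment ℝ q (Z e), g y ≤ 0 := by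
    intro e h y hy
    by_cases hy1 : y = q
    · rw [hy1, hgq]
    by_cases hy2 : y = Z e
    · rw [hy2, (hZB e h).1]
    exact (lensGauge_neg_of_mem_openSegment hwq hε (hZq e h).symm hgq.le (hZB e h).1.le
      (mem_openSegment_of_ne_left_right (Ne.symm hy1) (Ne.symm hy2) hy)).le
  set pos' : W → Plane := Function.update P.pos w q with hpos'
  set arc' : Sym2 W → Set Plane := fun e =>
    if e = e₀ then A else if w ∈ e then segment ℝ q (Z e) ∪ B e else P.arc e with harc'
  have posw : pos' w = q := Function.update_self ..
  have posy : ∀ y, y ≠ w → pos' y = P.pos y := fun y hy => Function.update_of_ne hy ..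
  have arc0 : arc' e₀ = A := if_pos rfl
  have arc1 : ∀ e, e ≠ e₀ → w ∈ e → arc' e = segment ℝ q (Z e) ∪ B e := fun e h1 h2 => by
    simp only [harc', if_neg h1, if_pos h2]
  have arc2 : ∀ e, w ∉ e → arc' e = P.arc e := fun e h => by
    simp only [harc', if_neg h]
    exact if_neg fun h' => h (by rw [h']; exact hwe₀)
  -- inside the lens, only `w` and the edges at `w` are left
  have hout : ∀ e ∈ H.edgeSet, ∀ p ∈ arc' e, p ∈ P.arc e ∧ p ≠ P.pos w ∨
      (w ∈ e ∧ e ≠ e₀ ∧ p ∈ segment ℝ q (Z e)) := by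
    intro e he p hp
    by_cases h0 : e = e₀
    · subst h0
      rw [arc0] at hp
      refine Or.inl ⟨hAe₀ hp, fun h => ?_⟩
      subst h
      exact hwq (hqA (left_mem_segment ℝ _ _) hp)
    by_cases hw : w ∈ e
    · rw [arc1 e h0 hw] at hp
      rcases hp with hp | hp
      · exact Or.inr ⟨hw, h0, hp⟩
      · obtain ⟨h1, h2, h3, h4, -⟩ := hZB e ⟨he, hw, h0⟩
        refine Or.inl ⟨h3 hp, fun h => ?_⟩
        subst h
        have := h4 _ hp hgw.le
        rw [← this] at h1
        exact hgw.ne h1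
    · rw [arc2 e hw] at hp
      refine Or.inl ⟨hp, fun h => ?_⟩
      subst h
      exact hgw.not_gt (F1 e he hw _ hp)
  have hlens : ∀ e ∈ H.edgeSet, e ≠ e₀ → w ∈ e → ∀ p ∈ segment ℝ q (Z e),
      ∀ f ∈ H.edgeSet, e ≠ f → p ∈ arc' f → p = q ∧ w ∈ f := by
    intro e he h0 hw p hp f hf hef hpf
    have hgp := hchord e ⟨he, hw, h0⟩ p hp
    by_cases hf0 : f = e₀
    · subst hf0
      rw [arc0] at hpf
      refine ⟨?_, hwe₀⟩
      by_contra hpq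
      exact hgp.not_gt (F3 p hpf hpq)
    by_cases hwf : w ∈ f
    · refine ⟨?_, hwf⟩
      obtain ⟨a1, a2, a3, -, -⟩ := hZB e ⟨he, hw, h0⟩
      obtain ⟨b1, b2, b3, b4, -⟩ := hZB f ⟨hf, hwf, hf0⟩
      have hne : Z e ≠ Z f := by
        intro h
        have := P.eq_pos_of_mem_arcs he hf hef hw hwf (a3 a2) (h ▸ b3 b2)
        rw [this] at a1
        exact hgw.ne a1
      rw [arc1 f hf0 hwf] at hpf
      have hpf' : p ∈ segment ℝ q (Z f) := by
        rcases hpf with hpf | hpf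
        · exact hpf
        · rw [b4 p hpf hgp]; exact right_mem_segment ℝ _ _
      exact chord_inter_chord hwq hε a1 b1 hne (hZq e ⟨he, hw, h0⟩) (hZq f ⟨hf, hwf, hf0⟩) hp hpf'
    · rw [arc2 f hwf] at hpf
      exact absurd (F1 f hf hwf p hpf) hgp.not_gt
  have hArcs : ∀ u, H.Adj w u → IsPolygonalArc (pos' w) (pos' u) (arc' s(w, u)) := by
    intro u hu
    rw [posw, posy u hu.ne']
    by_cases h0 : s(w, u) = e₀
    · rw [h0, arc0, Sym2.congr_right.1 h0]
      exact hA
    · have h : s(w, u) ∈ H.edgeSet ∧ w ∈ s(w, u) ∧ s(w, u) ≠ e₀ :=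
        ⟨hu, Sym2.mem_mk_left w u, h0⟩
      rw [arc1 _ h0 h.2.1]
      obtain ⟨h1, h2, h3, h4, h5⟩ := hZB _ h
      refine .cons (hZq _ h).symm (h5 u rfl) (Set.Subset.antisymm ?_ ?_)
      · rintro y ⟨hy, hyB⟩
        exact h4 y hyB (hchord _ h y hy)
      · rintro _ rfl
        exact ⟨right_mem_segment ℝ _ _, h2⟩
  refine ⟨⟨pos', arc', ?_, ?_, ?_, ?_⟩, posw, posy, arc0, arc2, ?_⟩
  · intro y z h
    by_cases hy : y = w
    · by_cases hz : z = w
      · rw [hy, hz]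
      · subst hy
        rw [posw, posy z hz] at h
        exact absurd h.symm (hqpos z)
    · by_cases hz : z = w
      · subst hz
        rw [posw, posy y hy] at h
        exact absurd h (hqpos y)
      · rw [posy y hy, posy z hz] at h
        exact P.pos_injective h
  · intro u v huv
    by_cases hu : u = w
    · subst hu; exact hArcs v huv
    by_cases hv : v = w
    · subst hv
      rw [Sym2.eq_swap]
      exact (hArcs u huv.symm).symm
    · rw [posy u hu, posy v hv, arc2 _ (by simp [Ne.symm hu, Ne.symm hv])]
      exact P.isPolygonalArc u v huv
  · intro e he y hy
    by_cases hyw : y = w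
    · subst hyw
      by_contra hwe
      rw [posw, arc2 e hwe] at hy
      exact (F1 e he hwe q hy).ne' hgq
    · rw [posy y hyw] at hy
      rcases hout e he _ hy with h | ⟨h1, h2, h3⟩
      · exact P.vertex_mem_arc e he y h.1
      · exact absurd (hchord e ⟨he, h1, h2⟩ _ h3) (F2 y hyw).not_ge
  · rintro e he f hf hef p ⟨hpe, hpf⟩
    rcases hout e he p hpe with h | ⟨h1, h2, h3⟩
    · rcases hout f hf p hpf with h' | ⟨h1', h2', h3'⟩
      · obtain ⟨u, hu, hu', rfl⟩ := P.arc_inter_arc e he f hf hef p ⟨h.1, h'.1⟩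
        exact ⟨u, hu, hu', posy u (fun hh => h.2 (hh ▸ rfl))⟩
      · obtain ⟨h4, h5⟩ := hlens f hf h2' h1' p h3' e he hef.symm hpe
        exact ⟨w, h5, h1', by rw [posw, h4]⟩
    · obtain ⟨h4, h5⟩ := hlens e he h2 h1 p h3 f hf hef hpf
      exact ⟨w, h1, h5, by rw [posw, h4]⟩
  · intro e he p hp
    rcases hout e he p hp with h | ⟨h1, h2, h3⟩
    · exact Or.inl h.1
    · exact Or.inr (eq_or_axial_pos hwq hε (hchord e ⟨he, h1, h2⟩ p h3))

end SimpleGraph.PlaneDrawing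

/-! ### Pulling the neighbours of a vertex onto a small circle -/

namespace SimpleGraph

namespace PlaneDrawing

open PlaneLens

variable {W : Type*} {H : SimpleGraph W}

/-- Moving `w` along the arc of the edge `wx`, one segment after the other, makes this edge
straight. -/
theorem exists_straighten [Finite W] (P : H.PlaneDrawing) {w x : W} (hwx : H.Adj w x) :
    ∃ P' : H.PlaneDrawing, P'.arc s(w, x) = segment ℝ (P'.pos w) (P'.pos x) ∧
      (∀ y, y ≠ w → P'.pos y = P.pos y) ∧ ∀ e, w ∉ e → P'.arc e = P.arc e := by
  have key : ∀ (p q : Plane) (A : Set Plane), IsPolygonalArc p q A → ∀ P : H.PlaneDrawing,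
      P.pos w = p → P.pos x = q → P.arc s(w, x) = A →
      ∃ P' : H.PlaneDrawing, P'.arc s(w, x) = segment ℝ (P'.pos w) (P'.pos x) ∧
        (∀ y, y ≠ w → P'.pos y = P.pos y) ∧ ∀ e, w ∉ e → P'.arc e = P.arc e := by
    intro p q A h
    induction h with
    | single h =>
      rintro P rfl rfl hP
      exact ⟨P, hP, fun _ _ => rfl, fun _ _ => rfl⟩
    | cons hpq hA hi ih =>
      rintro P rfl rfl hP
      obtain ⟨P₁, h1, h2, h3, h4, -⟩ := P.exists_move hwx hpq hA hi hP
      obtain ⟨P₂, k1, k2, k3⟩ := ih P₁ h1 (h2 x hwx.ne') h3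
      exact ⟨P₂, k1, fun y hy => (k2 y hy).trans (h2 y hy), fun e he => (k3 e he).trans (h4 e he)⟩
  exact key _ _ _ (P.isPolygonalArc w x hwx) P rfl rfl rfl

theorem exists_straight_star [Finite W] (P : H.PlaneDrawing) (x : W) :
    ∃ P' : H.PlaneDrawing, ∀ w, H.Adj w x → P'.arc s(w, x) = segment ℝ (P'.pos w) (P'.pos x) := by
  classical
  have := Fintype.ofFinite W
  have key : ∀ T : Finset W, ∃ P' : H.PlaneDrawing, ∀ w ∈ T, H.Adj w x →
      P'.arc s(w, x) = segment ℝ (P'.pos w) (P'.pos x) := by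
    intro T
    induction T using Finset.induction_on with
    | empty => exact ⟨P, by simp⟩
    | insert w T hw ih =>
      obtain ⟨P₁, h1⟩ := ih
      by_cases hwx : H.Adj w x
      · obtain ⟨P₂, k1, k2, k3⟩ := P₁.exists_straighten hwx
        refine ⟨P₂, fun y hy hyx => ?_⟩
        rcases Finset.mem_insert.1 hy with rfl | hy
        · exact k1
        · have hyw : y ≠ w := fun h => hw (h ▸ hy)
          rw [k3 _ (by simp [hyw.symm, hwx.ne]), k2 y hyw, k2 x hwx.ne']
          exact h1 y hy hyx
      · refine ⟨P₁, fun y hy hyx => ?_⟩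
        rcases Finset.mem_insert.1 hy with rfl | hy
        · exact absurd hyx hwx
        · exact h1 y hy hyx
  obtain ⟨P', h⟩ := key Finset.univ
  exact ⟨P', fun w hw => h w (Finset.mem_univ _) hw⟩

/-- A planar graph has a drawing in which the neighbours of a given vertex `x` lie on a circle
around `x` and everything that is not incident with `x` stays outside of this circle. -/
theorem exists_circular_star [Finite W] (P : H.PlaneDrawing) (x : W) :
    ∃ (P' : H.PlaneDrawing) (r : ℝ), (∀ w, H.Adj w x → Dist.dist (P'.pos w) (P'.pos x) = r) ∧
      (∀ y, y ≠ x → Dist.dist (P'.pos y) (P'.pos x) ≤ r → H.Adj y x) ∧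
      ∀ e ∈ H.edgeSet, x ∉ e → ∀ p ∈ P'.arc e, Dist.dist p (P'.pos x) ≤ r →
        ∃ w ∈ e, H.Adj w x ∧ P'.pos w = p := by
  classical
  have := Fintype.ofFinite W
  obtain ⟨P, hP⟩ := P.exists_straight_star x
  set o := P.pos x with ho
  obtain ⟨r, hr0, hr1, hr2⟩ : ∃ r : ℝ, 0 < r ∧ (∀ y, y ≠ x → r < Dist.dist (P.pos y) o) ∧
      ∀ e ∈ H.edgeSet, x ∉ e → ∀ p ∈ P.arc e, r < Dist.dist p o := by
    have a1 : ∀ᶠ r in 𝓝[>] (0 : ℝ), ∀ y, y ≠ x → r < Dist.dist (P.pos y) o := by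
      refine eventually_all.2 fun y => ?_
      by_cases hy : y = x
      · exact Eventually.of_forall fun r h => absurd hy h
      · have : 0 < Dist.dist (P.pos y) o := dist_pos.2 fun h => hy (P.pos_injective h)
        filter_upwards [nhdsWithin_le_nhds (eventually_lt_nhds this)] with r hr _ using hr
    have a2 : ∀ᶠ r in 𝓝[>] (0 : ℝ), ∀ e, e ∈ H.edgeSet ∧ x ∉ e → ∀ p ∈ P.arc e, r < Dist.dist p o := by
      refine eventually_all.2 fun e => ?_
      by_cases h : e ∈ H.edgeSet ∧ x ∉ e
      · rcases (P.arc e).eq_empty_or_nonempty with h0 | hne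
        · simp [h0]
        · obtain ⟨p₀, hp₀, hmin⟩ := (P.isCompact_arc h.1).exists_isMinOn hne
            (f := fun p => Dist.dist p o) (by fun_prop)
          have : 0 < Dist.dist p₀ o := dist_pos.2 fun h0 =>
            h.2 (P.vertex_mem_arc e h.1 x (by rw [← ho, ← h0]; exact hp₀))
          filter_upwards [nhdsWithin_le_nhds (eventually_lt_nhds this)] with r hr _ p hp
          exact lt_of_lt_of_le hr (hmin hp)
      · exact Eventually.of_forall fun ε h1 => absurd h1 h
    obtain ⟨r, h1, h2, h3⟩ := (a1.and (a2.and self_mem_nhdsWithin)).exists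
    exact ⟨r, h3, h1, fun e he hx => h2 e ⟨he, hx⟩⟩
  -- `T` is the set of neighbours of `x` that have already been placed on the circle
  have key : ∀ T : Finset W, (∀ w ∈ T, H.Adj w x) → ∃ P' : H.PlaneDrawing, P'.pos x = o ∧
      (∀ w, H.Adj w x → P'.arc s(w, x) = segment ℝ (P'.pos w) o) ∧
      (∀ w ∈ T, Dist.dist (P'.pos w) o = r) ∧ (∀ w ∉ T, w ≠ x → r < Dist.dist (P'.pos w) o) ∧
      ∀ e ∈ H.edgeSet, x ∉ e → ∀ p ∈ P'.arc e, Dist.dist p o ≤ r → ∃ w ∈ e, w ∈ T ∧ P'.pos w = p := by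
    intro T
    induction T using Finset.induction_on with
    | empty =>
      refine fun _ => ⟨P, rfl, hP, by simp, fun w _ hw => hr1 w hw, fun e he hx p hp hpr => ?_⟩
      exact absurd hpr (hr2 e he hx p hp).not_ge
    | insert w T hw ih =>
      intro hT
      obtain ⟨P₁, h1, h2, h3, h4, h5⟩ := ih fun y hy => hT y (Finset.mem_insert_of_mem hy)
      have hwx : H.Adj w x := hT w (Finset.mem_insert_self _ _)
      set d := Dist.dist (P₁.pos w) o with hd
      have hrd : r < d := h4 w hw hwx.ne
      have hd0 : 0 < d := hr0.trans hrd
      set q : Plane := AffineMap.lineMap o (P₁.pos w) (r / d) with hq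
      have hqs : q ∈ segment ℝ (P₁.pos w) o := by
        rw [segment_symm]
        exact mem_segment_iff_wbtw.2 ⟨r / d, ⟨by positivity, (div_le_one hd0).2 hrd.le⟩, rfl⟩
      have hqo : Dist.dist q o = r := by
        rw [hq, dist_lineMap_left, _root_.dist_comm, ← hd, Real.norm_of_nonneg (by positivity)]
        field_simp
      have hwq : P₁.pos w ≠ q := by
        intro h
        rw [← h] at hqo
        exact hrd.ne' hqo
      have hqo' : q ≠ o := by
        intro h
        rw [h, _root_.dist_self] at hqo
        exact hr0.ne hqo
      have hsub : P₁.pos w - q = ((d - r) / r) • (q - o) := by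
        rw [hq, AffineMap.lineMap_apply]
        simp only [vsub_eq_sub, vadd_eq_add]
        rw [add_sub_cancel_right, smul_smul]
        have : (d - r) / r * (r / d) = 1 - r / d := by field_simp
        rw [this, sub_smul, one_smul]
        abel
      have hw1 := Plane.segment_eq_union hqs
      have hw2 := Plane.segment_inter_segment hqs
      obtain ⟨P₂, k1, k2, k3, k4, k5⟩ := P₁.exists_move hwx hwq (A := segment ℝ q o)
        (by rw [h1]; exact .single hqo') hw2 (by rw [h2 w hwx, hw1])
      -- the lens of the move lies beyond the tangent of the circle at `q`
      have hball : ∀ p, (p = q ∨ 0 < axial (P₁.pos w) q p) → Dist.dist p o ≤ r → p = q := by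
        rintro p (hp | hp) hpr
        · exact hp
        · exfalso
          rw [axial_pos_iff_inner_pos hwq, hsub, inner_smul_right] at hp
          have hp' : 0 < inner ℝ (p - q) (q - o) :=
            (mul_pos_iff_of_pos_left (div_pos (by linarith) hr0)).1 hp
          have e : p - o = (p - q) + (q - o) := by abel
          have h6 := norm_add_sq_real (p - q) (q - o)
          rw [← e, ← dist_eq_norm, ← dist_eq_norm q o, hqo] at h6
          nlinarith [sq_nonneg ‖p - q‖, dist_nonneg (x := p) (y := o)]
      refine ⟨P₂, (k2 x hwx.ne').trans h1, ?_, ?_, ?_, ?_⟩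
      · intro y hyx
        by_cases hy : y = w
        · subst hy; rw [k3, k1]
        · rw [k4 _ (by simp [Ne.symm hy, hwx.ne]), k2 y hy, h2 y hyx]
      · intro y hy
        by_cases hyw : y = w
        · subst hyw; rw [k1, hqo]
        · rw [k2 y hyw]; exact h3 y ((Finset.mem_insert.1 hy).resolve_left hyw)
      · intro y hy hyx
        rw [Finset.mem_insert, not_or] at hy
        rw [k2 y hy.1]
        exact h4 y hy.2 hyx
      · intro e he hxe p hp hpr
        have old : p ∈ P₁.arc e → ∃ u ∈ e, u ∈ insert w T ∧ P₂.pos u = p := by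
          intro hp
          obtain ⟨u, hue, huT, rfl⟩ := h5 e he hxe p hp hpr
          exact ⟨u, hue, Finset.mem_insert_of_mem huT, k2 u (by rintro rfl; exact hw huT)⟩
        by_cases hwe : w ∈ e
        · rcases k5 e he hp with hp' | hp'
          · exact old hp'
          · obtain rfl := hball p hp' hpr
            exact ⟨w, hwe, Finset.mem_insert_self _ _, k1⟩
        · rw [k4 e hwe] at hp
          exact old hp
  obtain ⟨P', h1, -, h3, h4, h5⟩ := key (Finset.univ.filter fun w => H.Adj w x) (by simp)
  refine ⟨P', r, fun w hw => ?_, fun y hy hyr => ?_, fun e he hx p hp hpr => ?_⟩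
  · rw [h1]; exact h3 w (by simpa using hw)
  · by_contra hn
    rw [h1] at hyr
    exact hyr.not_gt (h4 y (by simpa using hn) hy)
  · rw [h1] at hpr
    obtain ⟨w, hw, hwT, hwp⟩ := h5 e he hx p hp hpr
    exact ⟨w, hw, by simpa using hwT, hwp⟩

end PlaneDrawing

end SimpleGraph

/-! ### Replacing a vertex by noncrossing chords -/

namespace SimpleGraph

variable {W : Type*} {H : SimpleGraph W}

/-- The straight line segment representing an edge when the vertices are placed by `c`. -/
def chord (c : W → Plane) : Sym2 W → Set Plane :=
  Sym2.lift ⟨fun u v => segment ℝ (c u) (c v), fun u v => segment_symm ℝ (c u) (c v)⟩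

/-- The straight line segments between the points `c u` and `c v`, for the edges `uv` of `K`, meet
only in common ends. -/
def NonCrossing (c : W → Plane) (K : SimpleGraph W) : Prop :=
  ∀ e ∈ K.edgeSet, ∀ f ∈ K.edgeSet, e ≠ f → ∀ p ∈ chord c e ∩ chord c f,
    ∃ y : W, y ∈ e ∧ y ∈ f ∧ c y = p

theorem IsPlanar.mono {H K : SimpleGraph W} (hK : K.IsPlanar) (h : H ≤ K) : H.IsPlanar := by
  obtain ⟨P⟩ := hK
  have hE : ∀ e ∈ H.edgeSet, e ∈ K.edgeSet := fun e he => edgeSet_mono h he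
  exact ⟨⟨P.pos, P.arc, P.pos_injective, fun x y hxy => P.isPolygonalArc x y (h hxy),
    fun e he => P.vertex_mem_arc e (hE e he),
    fun e he f hf => P.arc_inter_arc e (hE e he) f (hE f hf)⟩⟩

theorem IsPlanar.comap {U : Type*} {f : U → W} (hH : H.IsPlanar) (hf : Function.Injective f) :
    (H.comap f).IsPlanar := by
  obtain ⟨P⟩ := hH
  have hE : ∀ e ∈ (H.comap f).edgeSet, e.map f ∈ H.edgeSet := by
    intro e he
    induction e with
    | _ x y => exact he
  refine ⟨⟨fun x => P.pos (f x), fun e => P.arc (e.map f), P.pos_injective.comp hf,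
    fun x y hxy => P.isPolygonalArc _ _ hxy, fun e he x hx => ?_, fun e he e' he' hne p hp => ?_⟩⟩
  · obtain ⟨y, hy, hyx⟩ := Sym2.mem_map.1 (P.vertex_mem_arc _ (hE e he) _ hx)
    rwa [← hf hyx]
  · obtain ⟨z, hz, hz', rfl⟩ := P.arc_inter_arc _ (hE e he) _ (hE e' he')
      (fun h => hne (Sym2.map.injective hf h)) p hp
    obtain ⟨y, hy, rfl⟩ := Sym2.mem_map.1 hz
    obtain ⟨y', hy', h⟩ := Sym2.mem_map.1 hz'
    exact ⟨y, hy, hf h ▸ hy', rfl⟩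

/-- In a planar graph, a vertex `x` can be replaced by noncrossing chords between its neighbours,
when these are placed suitably on a circle. The vertex `x` stays as an isolated vertex. -/
theorem IsPlanar.exists_circle [Finite W] (hH : H.IsPlanar) (x : W) :
    ∃ (o : Plane) (r : ℝ) (c : W → Plane), Function.Injective c ∧
      (∀ w, H.Adj x w → Dist.dist (c w) o = r) ∧
      ∀ K : SimpleGraph W, (∀ u v, K.Adj u v → H.Adj x u) → NonCrossing c K →
        (H.deleteIncidenceSet x ⊔ K).IsPlanar := by
  classical
  obtain ⟨P₀⟩ := hH
  obtain ⟨P, r, h1, h2, h3⟩ := P₀.exists_circular_star x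
  set o := P.pos x with ho
  refine ⟨o, r, P.pos, P.pos_injective, fun w hw => h1 w hw.symm, fun K hK hnc => ?_⟩
  have hdel : ∀ e, e ∈ (H.deleteIncidenceSet x).edgeSet → e ∈ H.edgeSet ∧ x ∉ e := by
    intro e he
    rw [edgeSet_deleteIncidenceSet] at he
    exact ⟨he.1, fun hx => he.2 ⟨he.1, hx⟩⟩
  have hKadj : ∀ e ∈ K.edgeSet, ∀ u ∈ e, H.Adj x u := by
    rintro e he u ⟨v, rfl⟩
    exact hK u v he
  have hball : ∀ e ∈ K.edgeSet, ∀ p ∈ chord P.pos e, Dist.dist p o ≤ r ∧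
      (Dist.dist p o = r → ∃ u ∈ e, P.pos u = p) := by
    intro e he
    induction e with
    | _ u v =>
      intro p hp
      have hu : P.pos u ∈ Metric.closedBall o r := (h1 u (hK u v he).symm).le
      have hv : P.pos v ∈ Metric.closedBall o r := (h1 v (hK v u (K.mem_edgeSet.1 he).symm).symm).le
      refine ⟨(convex_closedBall o r).segment_subset hu hv hp, fun hpr => ?_⟩
      by_contra! hn
      have hlt := openSegment_subset_ball_of_ne hu hv
        (fun h => K.ne_of_adj he (P.pos_injective h))
        (mem_openSegment_of_ne_left_right (hn u (Sym2.mem_mk_left _ _))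
          (hn v (Sym2.mem_mk_right _ _)) hp)
      exact (Metric.mem_ball.1 hlt).ne hpr
  -- a new place for `x`, away from everything else
  obtain ⟨far, hfar⟩ : ∃ far, far ∉ (⋃ e ∈ H.edgeSet, P.arc e) ∪ Metric.closedBall o r ∪
      Set.range P.pos := by
    have hc : IsCompact ((⋃ e ∈ H.edgeSet, P.arc e) ∪ Metric.closedBall o r ∪
        Set.range P.pos) :=
      (((Set.toFinite H.edgeSet).isCompact_biUnion fun e he => P.isCompact_arc he).union
        (isCompact_closedBall o r)).union (Set.finite_range P.pos).isCompact
    by_contra! hn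
    exact hc.ne_univ (Set.eq_univ_of_forall hn)
  simp only [Set.mem_union, Set.mem_iUnion, Metric.mem_closedBall, Set.mem_range, not_or, not_exists,
    not_le] at hfar
  obtain ⟨⟨f1, f2⟩, f3⟩ := hfar
  set pos' := Function.update P.pos x far with hpos'
  set arc' : Sym2 W → Set Plane := fun e =>
    if e ∈ (H.deleteIncidenceSet x).edgeSet then P.arc e else chord P.pos e with harc'
  have posx : pos' x = far := Function.update_self ..
  have posy : ∀ y, y ≠ x → pos' y = P.pos y := fun y hy => Function.update_of_ne hy ..
  have harc : ∀ e ∈ (H.deleteIncidenceSet x ⊔ K).edgeSet,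
      (e ∈ H.edgeSet ∧ x ∉ e ∧ arc' e = P.arc e) ∨ (e ∈ K.edgeSet ∧ x ∉ e ∧
        arc' e = chord P.pos e) := by
    intro e he
    by_cases h : e ∈ (H.deleteIncidenceSet x).edgeSet
    · exact Or.inl ⟨(hdel e h).1, (hdel e h).2, if_pos h⟩
    · rw [edgeSet_sup] at he
      have hk := he.resolve_left h
      exact Or.inr ⟨hk, fun hx => H.irrefl (hKadj e hk x hx), if_neg h⟩
  have hcross : ∀ e ∈ K.edgeSet, ∀ f ∈ H.edgeSet, x ∉ f → ∀ p ∈ chord P.pos e, p ∈ P.arc f →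
      ∃ u, u ∈ e ∧ u ∈ f ∧ P.pos u = p := by
    intro e he f hf hx p hpe hpf
    obtain ⟨u, huf, hux, rfl⟩ := h3 f hf hx p hpf (hball e he p hpe).1
    obtain ⟨u', hu', h⟩ := (hball e he _ hpe).2 (h1 u hux)
    rw [P.pos_injective h] at hu'
    exact ⟨u, hu', huf, rfl⟩
  refine ⟨⟨pos', arc', ?_, ?_, ?_, ?_⟩⟩
  · intro y z h
    by_cases hy : y = x
    · by_cases hz : z = x
      · rw [hy, hz]
      · rw [hy, posx, posy z hz] at h
        exact absurd h.symm (f3 z)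
    · by_cases hz : z = x
      · rw [hz, posx, posy y hy] at h
        exact absurd h (f3 y)
      · rw [posy y hy, posy z hz] at h
        exact P.pos_injective h
  · intro u v huv
    rcases harc s(u, v) huv with ⟨he, hx, ha⟩ | ⟨he, hx, ha⟩ <;>
    · rw [Sym2.mem_iff, not_or] at hx
      rw [posy u (Ne.symm hx.1), posy v (Ne.symm hx.2), ha]
      first
        | exact P.isPolygonalArc u v he
        | exact .single fun h => K.ne_of_adj he (P.pos_injective h)
  · intro e he y hy
    by_cases hyx : y = x
    · rw [hyx, posx] at hy
      rcases harc e he with ⟨he, hx, ha⟩ | ⟨he, hx, ha⟩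
      · rw [ha] at hy
        exact absurd hy (f1 e he)
      · rw [ha] at hy
        exact absurd (hball e he _ hy).1 f2.not_ge
    · rw [posy y hyx] at hy
      rcases harc e he with ⟨he, hx, ha⟩ | ⟨he, hx, ha⟩
      · rw [ha] at hy
        exact P.vertex_mem_arc e he y hy
      · rw [ha] at hy
        have hb := hball e he _ hy
        obtain ⟨u, hu, h⟩ := hb.2 (h1 y (h2 y hyx hb.1))
        rwa [P.pos_injective h] at hu
  · rintro e he f hf hef p ⟨hpe, hpf⟩
    have key : ∃ u, u ∈ e ∧ u ∈ f ∧ P.pos u = p ∧ u ≠ x := by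
      rcases harc e he with ⟨he, hx, ha⟩ | ⟨he, hx, ha⟩ <;>
      rcases harc f hf with ⟨hf, hx', ha'⟩ | ⟨hf, hx', ha'⟩ <;>
      rw [ha] at hpe <;> rw [ha'] at hpf
      · obtain ⟨u, hu, hu', h⟩ := P.arc_inter_arc e he f hf hef p ⟨hpe, hpf⟩
        exact ⟨u, hu, hu', h, by rintro rfl; exact hx hu⟩
      · obtain ⟨u, hu, hu', h⟩ := hcross f hf e he hx p hpf hpe
        exact ⟨u, hu', hu, h, by rintro rfl; exact hx hu'⟩
      · obtain ⟨u, hu, hu', h⟩ := hcross e he f hf hx' p hpe hpf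
        exact ⟨u, hu, hu', h, by rintro rfl; exact hx hu⟩
      · obtain ⟨u, hu, hu', h⟩ := hnc e he f hf hef p ⟨hpe, hpf⟩
        exact ⟨u, hu, hu', h, by rintro rfl; exact hx hu⟩
    obtain ⟨u, hu, hu', h, hux⟩ := key
    exact ⟨u, hu, hu', by rw [posy u hux, h]⟩

/-- Contracting an edge `uv` of a planar graph gives a planar graph: `u` is replaced by the fan of
chords from `v` to the other neighbours of `u`. -/
theorem IsPlanar.contract [Finite W] (hH : H.IsPlanar) {u v : W} (huv : H.Adj u v)
    {H' : SimpleGraph W} (hH' : ∀ a b, H'.Adj a b →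
      (H.Adj a b ∧ a ≠ u ∧ b ≠ u) ∨ (a = v ∧ H.Adj u b) ∨ (b = v ∧ H.Adj u a)) :
    H'.IsPlanar := by
  obtain ⟨o, r, c, hc, hcr, hK⟩ := hH.exists_circle u
  let K : SimpleGraph W :=
    { Adj := fun a b => a ≠ b ∧ ((a = v ∧ H.Adj u b) ∨ (b = v ∧ H.Adj u a))
      symm := ⟨fun a b h => ⟨h.1.symm, h.2.symm⟩⟩
      loopless := ⟨fun a h => h.1 rfl⟩ }
  have hKe : ∀ e ∈ K.edgeSet, ∃ b, b ≠ v ∧ H.Adj u b ∧ e = s(v, b) := by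
    intro e he
    induction e with
    | _ a b =>
      obtain ⟨h, ⟨rfl, h'⟩ | ⟨rfl, h'⟩⟩ := he
      · exact ⟨b, h.symm, h', rfl⟩
      · exact ⟨a, h, h', Sym2.eq_swap⟩
  refine (hK K ?_ ?_).mono ?_
  · rintro a b ⟨-, ⟨rfl, -⟩ | ⟨-, h⟩⟩
    · exact huv
    · exact h
  · intro e he f hf hef p ⟨hpe, hpf⟩
    obtain ⟨a, hav, ha, rfl⟩ := hKe e he
    obtain ⟨b, hbv, hb, rfl⟩ := hKe f hf
    refine ⟨v, Sym2.mem_mk_left _ _, Sym2.mem_mk_left _ _, ?_⟩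
    by_contra hpv
    have hab : a ≠ b := by rintro rfl; exact hef rfl
    have aux : ∀ a b, a ≠ v → b ≠ v → a ≠ b → H.Adj u a → H.Adj u b →
        ¬ Wbtw ℝ (c v) (c a) (c b) := by
      intro a b hav hbv hab ha hb h
      have hlt := openSegment_subset_ball_of_ne (z := o) (r := r)
        (Metric.mem_closedBall.2 (hcr v huv).le) (Metric.mem_closedBall.2 (hcr b hb).le)
        (fun h => hbv (hc h).symm) (mem_openSegment_of_ne_left_right (fun h => hav (hc h).symm)
          (fun h => hab (hc h).symm) (mem_segment_iff_wbtw.2 h))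
      exact (Metric.mem_ball.1 hlt).ne (hcr a ha)
    exact (Plane.wbtw_or_wbtw_of_mem_segments (Ne.symm hpv) hpe hpf).elim
      (aux a b hav hbv hab ha hb) (aux b a hbv hav hab.symm hb ha)
  · intro a b hab
    rcases hH' a b hab with h | h
    · exact Or.inl (deleteIncidenceSet_adj.2 h)
    · exact Or.inr ⟨hab.ne, h⟩

end SimpleGraph

/-! ### Chords of a coloured convex polygon -/

namespace SimpleGraph

/-- Twice the signed area of the triangle `pqr`; it is positive if `p`, `q`, `r` are in
counterclockwise order. -/
def orient (p q r : Plane) : ℝ :=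
  (q 0 - p 0) * (r 1 - p 1) - (q 1 - p 1) * (r 0 - p 0)

theorem orient_rotate (p q r : Plane) : orient q r p = orient p q r := by
  unfold orient; ring

theorem orient_swap (p q r : Plane) : orient p r q = -orient p q r := by
  unfold orient; ring

theorem orient_self_left (p q : Plane) : orient p q p = 0 := by
  unfold orient; ring

theorem orient_self_right (p q : Plane) : orient p q q = 0 := by
  unfold orient; ring

theorem orient_comb (p q y z : Plane) {a b : ℝ} (hab : a + b = 1) :
    orient p q (a • y + b • z) = a * orient p q y + b * orient p q z := by
  obtain rfl : b = 1 - a := by linarith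
  simp only [orient, PiLp.add_apply, PiLp.smul_apply, smul_eq_mul]
  ring

/-- Points on a circle are in counterclockwise order if their angles increase: the signed area is a
product of sines of half differences of the angles. -/
theorem orient_pos_of_angles {o p q r : Plane} {ρ α β γ : ℝ} (hρ : 0 < ρ) (hα : -Real.pi < α)
    (hαβ : α < β) (hβγ : β < γ) (hγ : γ ≤ Real.pi)
    (hp0 : p 0 = o 0 + ρ * Real.cos α) (hp1 : p 1 = o 1 + ρ * Real.sin α)
    (hq0 : q 0 = o 0 + ρ * Real.cos β) (hq1 : q 1 = o 1 + ρ * Real.sin β)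
    (hr0 : r 0 = o 0 + ρ * Real.cos γ) (hr1 : r 1 = o 1 + ρ * Real.sin γ) :
    0 < orient p q r := by
  have h1 : 0 < Real.sin ((β - α) / 2) :=
    Real.sin_pos_of_pos_of_lt_pi (by linarith) (by linarith)
  have h2 : 0 < Real.sin ((γ - β) / 2) :=
    Real.sin_pos_of_pos_of_lt_pi (by linarith) (by linarith)
  have h3 : 0 < Real.sin ((γ - α) / 2) :=
    Real.sin_pos_of_pos_of_lt_pi (by linarith) (by linarith)
  have key : orient p q r = 4 * ρ ^ 2 *
      (Real.sin ((β - α) / 2) * Real.sin ((γ - β) / 2) * Real.sin ((γ - α) / 2)) := by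
    have e1 : Real.cos β - Real.cos α = -2 * Real.sin ((β + α) / 2) * Real.sin ((β - α) / 2) :=
      Real.cos_sub_cos β α
    have e2 : Real.sin β - Real.sin α = 2 * Real.sin ((β - α) / 2) * Real.cos ((β + α) / 2) :=
      Real.sin_sub_sin β α
    have e3 : Real.cos γ - Real.cos α = -2 * Real.sin ((γ + α) / 2) * Real.sin ((γ - α) / 2) :=
      Real.cos_sub_cos γ α
    have e4 : Real.sin γ - Real.sin α = 2 * Real.sin ((γ - α) / 2) * Real.cos ((γ + α) / 2) :=
      Real.sin_sub_sin γ α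
    have e5 : Real.sin ((γ - β) / 2) = Real.sin ((γ + α) / 2) * Real.cos ((β + α) / 2) -
        Real.cos ((γ + α) / 2) * Real.sin ((β + α) / 2) := by
      rw [← Real.sin_sub]; congr 1; ring
    have f1 : q 0 - p 0 = ρ * (Real.cos β - Real.cos α) := by rw [hq0, hp0]; ring
    have f2 : q 1 - p 1 = ρ * (Real.sin β - Real.sin α) := by rw [hq1, hp1]; ring
    have f3 : r 0 - p 0 = ρ * (Real.cos γ - Real.cos α) := by rw [hr0, hp0]; ring
    have f4 : r 1 - p 1 = ρ * (Real.sin γ - Real.sin α) := by rw [hr1, hp1]; ring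
    rw [orient, f1, f2, f3, f4, e1, e2, e3, e4, e5]
    ring
  rw [key]
  positivity

variable {W γ : Type*}

/-- The points of a list of vertices are in counterclockwise order on the boundary of a convex
polygon. -/
def IsConvexPolygon (c : W → Plane) (L : List W) : Prop :=
  L.Triplewise fun x y z => 0 < orient (c x) (c y) (c z)

theorem IsConvexPolygon.isRotated {c : W → Plane} {L L' : List W} (h : IsConvexPolygon c L)
    (hL : L ~r L') : IsConvexPolygon c L' := by
  obtain ⟨n, rfl⟩ := hL
  rw [List.rotate_eq_drop_append_take_mod]
  set m := n % L.length
  rw [IsConvexPolygon, ← List.take_append_drop m L, List.triplewise_append] at h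
  obtain ⟨h1, h2, h3, h4⟩ := h
  refine List.triplewise_append.2 ⟨h2, h1, fun a ha => ?_, fun a ha => ?_⟩
  · refine (h4 a ha).imp fun {x y} hxy => ?_
    rwa [← orient_rotate]
  · refine (h3 a ha).imp fun {x y} hxy => ?_
    rwa [orient_rotate]

/-- Points on a circle are the vertices of a convex polygon. -/
theorem exists_isConvexPolygon {o : Plane} {ρ : ℝ} {c : W → Plane} (hc : Function.Injective c)
    (S : Finset W) (hS : ∀ w ∈ S, Dist.dist (c w) o = ρ) :
    ∃ L : List W, L.Nodup ∧ (∀ w, w ∈ L ↔ w ∈ S) ∧ IsConvexPolygon c L := by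
  classical
  let ζ : W → ℂ := fun w => ⟨c w 0 - o 0, c w 1 - o 1⟩
  let θ : W → ℝ := fun w => (ζ w).arg
  have hζ : ∀ w ∈ S, ‖ζ w‖ = ρ := by
    intro w hw
    rw [← hS w hw, EuclideanSpace.dist_eq, Complex.norm_def, Complex.normSq_mk]
    simp [Fin.sum_univ_two, Real.dist_eq, sq]
  have h0 : ∀ w ∈ S, c w 0 = o 0 + ρ * Real.cos (θ w) := by
    intro w hw
    have := Complex.norm_mul_cos_arg (ζ w)
    rw [hζ w hw] at this
    change ρ * Real.cos (θ w) = c w 0 - o 0 at this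
    linarith
  have h1 : ∀ w ∈ S, c w 1 = o 1 + ρ * Real.sin (θ w) := by
    intro w hw
    have := Complex.norm_mul_sin_arg (ζ w)
    rw [hζ w hw] at this
    change ρ * Real.sin (θ w) = c w 1 - o 1 at this
    linarith
  have hθ : ∀ u ∈ S, ∀ v ∈ S, θ u = θ v → u = v := by
    intro u hu v hv h
    apply hc
    ext i
    fin_cases i
    · simp only [Fin.zero_eta]
      rw [h0 u hu, h0 v hv, h]
    · simp only [Fin.mk_one]
      rw [h1 u hu, h1 v hv, h]
  let r : W → W → Prop := fun a b => θ a ≤ θ b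
  have : Std.Total r := ⟨fun a b => le_total _ _⟩
  have : IsTrans W r := ⟨fun a b d => le_trans⟩
  have hperm := List.perm_insertionSort r S.toList
  have hmem : ∀ w, w ∈ S.toList.insertionSort r ↔ w ∈ S := fun w => by
    rw [hperm.mem_iff, Finset.mem_toList]
  have hnd : (S.toList.insertionSort r).Nodup := hperm.nodup_iff.2 S.nodup_toList
  refine ⟨_, hnd, hmem, ?_⟩
  have hlt : (S.toList.insertionSort r).Pairwise fun a b => θ a < θ b := by
    refine ((List.pairwise_insertionSort r S.toList).and hnd).imp_of_mem
      fun {a b} ha hb hab => lt_of_le_of_ne hab.1 fun h => hab.2 ?_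
    exact hθ a ((hmem a).1 ha) b ((hmem b).1 hb) h
  refine List.triplewise_iff_getElem.2 fun i j k hij hjk hk => ?_
  have m1 := (hmem _).1 (List.getElem_mem (hij.trans (hjk.trans hk)))
  have m2 := (hmem _).1 (List.getElem_mem (hjk.trans hk))
  have m3 := (hmem _).1 (List.getElem_mem hk)
  have l1 := List.pairwise_iff_getElem.1 hlt i j (hij.trans (hjk.trans hk)) (hjk.trans hk) hij
  have l2 := List.pairwise_iff_getElem.1 hlt j k (hjk.trans hk) hk hjk
  have hρ : 0 < ρ := by
    have hn : 0 ≤ ρ := by rw [← hζ _ m1]; exact norm_nonneg _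
    refine hn.lt_of_ne fun hρ => l1.ne ?_
    congr 1
    apply hc
    ext t
    fin_cases t
    · simp only [Fin.zero_eta]
      rw [h0 _ m1, h0 _ m2, ← hρ]; ring
    · simp only [Fin.mk_one]
      rw [h1 _ m1, h1 _ m2, ← hρ]; ring
  exact orient_pos_of_angles hρ (Complex.neg_pi_lt_arg _) l1 l2 (Complex.arg_le_pi _)
    (h0 _ m1) (h1 _ m1) (h0 _ m2) (h1 _ m2) (h0 _ m3) (h1 _ m3)

/-- If each end of the segment `uv` is `q` or lies strictly on one fixed side of the line `g = 0`
through `p` and `q`, then the segments `uv` and `pq` can meet only in `q`. -/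
theorem eq_of_mem_segments {c : W → Plane} {g : Plane → ℝ}
    (hg : ∀ y z {a b : ℝ}, a + b = 1 → g (a • y + b • z) = a * g y + b * g z) {p q u v : W}
    (hp : g (c p) = 0) (hq : g (c q) = 0) (hu : u = q ∨ 0 < g (c u)) (hv : v = q ∨ 0 < g (c v))
    {y : Plane} (hy : y ∈ segment ℝ (c u) (c v)) (hy' : y ∈ segment ℝ (c p) (c q)) :
    y = c q ∧ (u = q ∨ v = q) := by
  have h0 : g y = 0 := by
    obtain ⟨a, b, -, -, hab, rfl⟩ := hy'
    rw [hg _ _ hab, hp, hq]; ring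
  obtain ⟨a, b, ha, hb, hab, rfl⟩ := hy
  rw [hg _ _ hab] at h0
  rcases hu with rfl | hu <;> rcases hv with rfl | hv
  · exact ⟨by rw [← add_smul, hab, one_smul], Or.inl rfl⟩
  · rw [hq, mul_zero, zero_add, mul_eq_zero, or_iff_left hv.ne'] at h0
    subst h0
    obtain rfl : a = 1 := by linarith
    exact ⟨by simp, Or.inl rfl⟩
  · rw [hq, mul_zero, add_zero, mul_eq_zero, or_iff_left hu.ne'] at h0
    subst h0
    obtain rfl : b = 1 := by linarith
    exact ⟨by simp, Or.inr rfl⟩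
  · exfalso
    have : 0 < a ∨ 0 < b := by
      by_contra! hn
      linarith
    rcases this with h | h
    · nlinarith [mul_pos h hu, mul_nonneg hb hv.le]
    · nlinarith [mul_pos h hv, mul_nonneg ha hu.le]

/-- The two sides of a convex polygon at a corner `p` do not cross chords between the other
corners. -/
theorem NonCrossing.sup_ear {c : W → Plane} {p q r : W} {m : List W}
    (hL : IsConvexPolygon c (p :: q :: (m ++ [r]))) {K : SimpleGraph W} (hK : NonCrossing c K)
    (hKL : ∀ u v, K.Adj u v → u ∈ q :: (m ++ [r])) :
    NonCrossing c (K ⊔ edge p q ⊔ edge p r) := by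
  have hp := (List.triplewise_cons.1 hL).1
  have hq : ∀ u ∈ q :: (m ++ [r]), u = q ∨ 0 < orient (c p) (c q) (c u) := by
    intro u hu
    rcases List.mem_cons.1 hu with h | h
    · exact Or.inl h
    · exact Or.inr ((List.pairwise_cons.1 hp).1 u h)
  have hr : ∀ u ∈ q :: (m ++ [r]), u = r ∨ 0 < -orient (c p) (c r) (c u) := by
    intro u hu
    rw [← List.cons_append] at hp hu
    rw [List.pairwise_append] at hp
    rcases List.mem_append.1 hu with h | h
    · right
      rw [← orient_swap]
      exact hp.2.2 u h r (List.mem_singleton_self r)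
    · exact Or.inl (List.mem_singleton.1 h)
  have hqr : 0 < orient (c p) (c q) (c r) :=
    (List.pairwise_cons.1 hp).1 r (by simp)
  have gq := fun y z (a b : ℝ) hab => orient_comb (c p) (c q) y z (a := a) (b := b) hab
  have gr : ∀ (y z : Plane) {a b : ℝ}, a + b = 1 → -orient (c p) (c r) (a • y + b • z) =
      a * -orient (c p) (c r) y + b * -orient (c p) (c r) z := by
    intro y z a b hab
    rw [orient_comb _ _ _ _ hab]; ring
  have hE : ∀ e ∈ (K ⊔ edge p q ⊔ edge p r).edgeSet,
      e ∈ K.edgeSet ∨ e = s(p, q) ∨ e = s(p, r) := by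
    intro e he
    induction e with
    | _ u v =>
      rcases he with (he | he) | he
      · exact Or.inl he
      · exact Or.inr (Or.inl (Sym2.eq_iff.2 ((edge_adj _ _ _ _).1 he).1))
      · exact Or.inr (Or.inr (Sym2.eq_iff.2 ((edge_adj _ _ _ _).1 he).1))
  have k1 : ∀ e ∈ K.edgeSet, ∀ y ∈ chord c e ∩ chord c s(p, q), q ∈ e ∧ c q = y := by
    intro e he
    induction e with
    | _ u v =>
      rintro y ⟨hy, hy'⟩
      obtain ⟨h1, h2⟩ := eq_of_mem_segments (fun y z a b hab => gq y z a b hab)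
        (orient_self_left _ _) (orient_self_right _ _) (hq u (hKL u v he))
        (hq v (hKL v u (K.mem_edgeSet.1 he).symm)) hy hy'
      exact ⟨Sym2.mem_iff.2 (h2.imp Eq.symm Eq.symm), h1.symm⟩
  have k2 : ∀ e ∈ K.edgeSet, ∀ y ∈ chord c e ∩ chord c s(p, r), r ∈ e ∧ c r = y := by
    intro e he
    induction e with
    | _ u v =>
      rintro y ⟨hy, hy'⟩
      obtain ⟨h1, h2⟩ := eq_of_mem_segments (g := fun y => -orient (c p) (c r) y) gr
        (by simp [orient_self_left]) (by simp [orient_self_right]) (hr u (hKL u v he))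
        (hr v (hKL v u (K.mem_edgeSet.1 he).symm)) hy hy'
      exact ⟨Sym2.mem_iff.2 (h2.imp Eq.symm Eq.symm), h1.symm⟩
  have k3 : ∀ y ∈ chord c s(p, q) ∩ chord c s(p, r), c p = y := by
    rintro y ⟨hy, hy'⟩
    rw [Sym2.eq_swap] at hy
    exact (eq_of_mem_segments (fun y z a b hab => gq y z a b hab)
      (orient_self_right _ _) (orient_self_left _ _) (Or.inl rfl) (Or.inr hqr) hy' hy).1.symm
  intro e he f hf hef y hy
  have hy' := hy.symm
  rcases hE e he with he | rfl | rfl <;> rcases hE f hf with hf | rfl | rfl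
  · exact hK e he f hf hef y hy
  · exact ⟨q, (k1 e he y hy).1, by simp, (k1 e he y hy).2⟩
  · exact ⟨r, (k2 e he y hy).1, by simp, (k2 e he y hy).2⟩
  · exact ⟨q, by simp, (k1 f hf y hy').1, (k1 f hf y hy').2⟩
  · exact absurd rfl hef
  · exact ⟨p, by simp, by simp, k3 y hy⟩
  · exact ⟨r, by simp, (k2 f hf y hy').1, (k2 f hf y hy').2⟩
  · exact ⟨p, by simp, by simp, k3 y hy'⟩
  · exact absurd rfl hef

/-- A vertex sees a colour if that colour occurs on a neighbour of the monochromatic component of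
the vertex. -/
def SeesColor (K : SimpleGraph W) (col : W → γ) (w : W) (t : γ) : Prop :=
  ∃ z z', Relation.ReflTransGen (fun u v => K.Adj u v ∧ col u = col v) w z ∧ K.Adj z z' ∧
    col z' = t

theorem SeesColor.mono {K K' : SimpleGraph W} (hK : K ≤ K') {col : W → γ} {w : W} {t : γ}
    (h : K.SeesColor col w t) : K'.SeesColor col w t := by
  obtain ⟨z, z', h1, h2, h3⟩ := h
  refine ⟨z, z', ?_, hK h2, h3⟩
  exact Relation.ReflTransGen.mono (fun u v huv => ⟨hK huv.1, huv.2⟩) w z h1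

theorem SeesColor.of_adj {K : SimpleGraph W} {col : W → γ} {w z : W} (h : K.Adj w z) :
    K.SeesColor col w (col z) := ⟨w, z, .refl, h, rfl⟩

theorem SeesColor.head {K : SimpleGraph W} {col : W → γ} {w z : W} {t : γ} (h : K.Adj w z)
    (hwz : col w = col z) (hz : K.SeesColor col z t) : K.SeesColor col w t := by
  obtain ⟨a, b, h1, h2, h3⟩ := hz
  exact ⟨a, b, .head ⟨h, hwz⟩ h1, h2, h3⟩

/-- In a cyclic list of length at least four with three colours, there is an element whose colour
occurs elsewhere and which is not enclosed by two elements of one and the same other colour: if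
there were none, then going around from an element with a repeated colour, two colours would
alternate. -/
theorem exists_ear {col : W → γ} {T : Finset γ} (hT : T.card = 3) {L : List W}
    (hL : 4 ≤ L.length) (h1 : ∀ w ∈ L, col w ∈ T) (h2 : ∀ t ∈ T, ∃ w ∈ L, col w = t) :
    ∃ p q r m, L ~r (p :: q :: (m ++ [r])) ∧ (∃ p' ∈ q :: (m ++ [r]), col p' = col p) ∧
      (col q = col p ∨ col r = col p ∨ col q ≠ col r) := by
  classical
  by_contra! hn
  set k := L.length with hk
  have hk0 : 0 < k := by omega
  set f : ℕ → γ := fun n => col (L[n % k]'(Nat.mod_lt _ hk0)) with hf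
  have hper : ∀ n j, f (n + j * k) = f n := by
    intro n j
    simp only [hf, Nat.add_mul_mod_self_right]
  -- the colours before and after an element with a repeated colour agree;
  -- the index `n + (k - 1)` stands for the predecessor of `n`
  have hstep : ∀ n, (∃ j, 0 < j ∧ j < k ∧ f (n + j) = f n) → f (n + 1) = f (n + (k - 1)) := by
    rintro n ⟨j, hj0, hjk, hj⟩
    have hlen : (L.rotate n).length = k := L.length_rotate n
    have hget : ∀ i (hi : i < (L.rotate n).length), col (L.rotate n)[i] = f (n + i) := by
      intro i hi
      simp only [hf]
      rw [List.getElem_rotate]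
      simp only [Nat.add_comm i n, ← hk]
    obtain ⟨p, q, m, r, hR⟩ : ∃ p q m r, L.rotate n = p :: q :: (m ++ [r]) := by
      match hM : L.rotate n with
      | [] => simp [hM] at hlen; omega
      | [_] => simp [hM] at hlen; omega
      | p :: q :: t =>
        have ht : t ≠ [] := by
          rintro rfl
          simp [hM] at hlen
          omega
        exact ⟨p, q, t.dropLast, t.getLast ht, by rw [List.dropLast_append_getLast ht]⟩
    have hm : m.length = k - 3 := by
      rw [← hlen, hR]; simp
    have e0 : col p = f n := by
      rw [← Nat.add_zero n, ← hget 0 (by omega)]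
      simp [hR]
    have e1 : col q = f (n + 1) := by
      rw [← hget 1 (by omega)]
      simp [hR]
    have e2 : col r = f (n + (k - 1)) := by
      rw [← hget (k - 1) (by omega)]
      simp only [hR]
      have : k - 1 = (m.length + 1) + 1 := by omega
      simp only [this, List.getElem_cons_succ, List.getElem_concat_length]
    have hmem : (L.rotate n)[j]'(by omega) ∈ q :: (m ++ [r]) := by
      obtain ⟨i, rfl⟩ : ∃ i, j = i + 1 := ⟨j - 1, by omega⟩
      simp only [hR, List.getElem_cons_succ]
      exact List.getElem_mem _
    have := (hn p q r m ⟨n, hR⟩ ⟨_, hmem, by rw [hget, hj, e0]⟩).2.2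
    rwa [e1, e2] at this
  -- hence the colour of the successor is repeated too, as `n + 1` and `n - 1` differ modulo `k`
  have hrep : ∀ n, (∃ j, 0 < j ∧ j < k ∧ f (n + j) = f n) →
      ∃ j, 0 < j ∧ j < k ∧ f (n + 1 + j) = f (n + 1) := by
    intro n h
    refine ⟨k - 2, by omega, by omega, ?_⟩
    rw [hstep n h]
    congr 1
    omega
  have hfT : ∀ n, f n ∈ T := fun n => h1 _ (List.getElem_mem _)
  obtain ⟨n₀, hn₀⟩ : ∃ n, ∃ j, 0 < j ∧ j < k ∧ f (n + j) = f n := by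
    obtain ⟨i, hi, j, hj, hij, h⟩ := Finset.exists_ne_map_eq_of_card_lt_of_maps_to
      (s := Finset.range k) (t := T) (f := f) (by rw [Finset.card_range, hT]; omega)
      (fun n _ => hfT n)
    rw [Finset.mem_range] at hi hj
    rcases lt_or_gt_of_ne hij with h' | h'
    · exact ⟨i, j - i, by omega, by omega, by rw [Nat.add_sub_cancel' h'.le, h]⟩
    · exact ⟨j, i - j, by omega, by omega, by rw [Nat.add_sub_cancel' h'.le, h]⟩
  have hall : ∀ m, ∃ j, 0 < j ∧ j < k ∧ f (n₀ + m + j) = f (n₀ + m) := by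
    intro m
    induction m with
    | zero => exact hn₀
    | succ m ih => exact hrep _ ih
  have htwo : ∀ m, f (n₀ + m + 2) = f (n₀ + m) := by
    intro m
    have h := hstep (n₀ + (m + 1)) (hall (m + 1))
    have e : n₀ + (m + 1) + (k - 1) = n₀ + m + 1 * k := by omega
    rw [e, hper] at h
    exact h
  have hpair : ∀ m, f (n₀ + m) ∈ ({f n₀, f (n₀ + 1)} : Finset γ) ∧
      f (n₀ + m + 1) ∈ ({f n₀, f (n₀ + 1)} : Finset γ) := by
    intro m
    induction m with
    | zero => simp
    | succ m ih => exact ⟨ih.2, by rw [show n₀ + (m + 1) + 1 = n₀ + m + 2 by omega, htwo]; exact ih.1⟩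
  have hsub : T ⊆ {f n₀, f (n₀ + 1)} := by
    intro t ht
    obtain ⟨w, hw, rfl⟩ := h2 t ht
    obtain ⟨i, hi, rfl⟩ := List.getElem_of_mem hw
    have e : col L[i] = f i := by
      simp only [hf]
      congr 2
      exact (Nat.mod_eq_of_lt hi).symm
    have e' : n₀ + (i + n₀ * (k - 1)) = i + n₀ * k := by
      obtain ⟨k', hk'⟩ : ∃ k', k = k' + 1 := ⟨k - 1, by omega⟩
      rw [hk', Nat.add_sub_cancel]; ring
    rw [e, ← hper i n₀, ← e']
    exact (hpair _).1
  have := (Finset.card_le_card hsub).trans Finset.card_le_two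
  omega

/-- A convex polygon whose corners are coloured with three colours has noncrossing chords such that
every monochromatic component sees the other two colours. The chords are found by cutting off one
corner after the other. -/
theorem exists_noncrossing_chords {c : W → Plane} {col : W → γ} {T : Finset γ} (hT : T.card = 3)
    {L : List W} (hnd : L.Nodup) (hL : IsConvexPolygon c L) (h1 : ∀ w ∈ L, col w ∈ T)
    (h2 : ∀ t ∈ T, ∃ w ∈ L, col w = t) :
    ∃ K : SimpleGraph W, (∀ u v, K.Adj u v → u ∈ L) ∧ NonCrossing c K ∧
      ∀ w ∈ L, ∀ t ∈ T, t ≠ col w → K.SeesColor col w t := by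
  classical
  induction hn : L.length using Nat.strong_induction_on generalizing L with
  | _ n ih =>
  subst hn
  have hTsub : T ⊆ (L.map col).toFinset := by
    intro t ht
    obtain ⟨w, hw, rfl⟩ := h2 t ht
    simpa using ⟨w, hw, rfl⟩
  have hlen : 3 ≤ L.length := by
    rw [← hT, ← List.length_map (f := col)]
    exact (Finset.card_le_card hTsub).trans (List.toFinset_card_le _)
  have hmemE : ∀ {K : SimpleGraph W} {p q r : W} {m : List W},
      (∀ u v, K.Adj u v → u ∈ q :: (m ++ [r])) → ∀ u v, (K ⊔ edge p q ⊔ edge p r).Adj u v →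
        u ∈ p :: q :: (m ++ [r]) := by
    intro K p q r m hK u v huv
    rcases huv with (h | h) | h
    · exact List.mem_cons_of_mem _ (hK u v h)
    · rcases ((edge_adj _ _ _ _).1 h).1 with h | h <;> simp [h.1]
    · rcases ((edge_adj _ _ _ _).1 h).1 with h | h <;> simp [h.1]
  rcases hlen.eq_or_lt with hlen | hlen
  -- in a triangle, the three colours are distinct, and all sides are taken
  · obtain ⟨p, q, r, rfl⟩ := List.length_eq_three.1 hlen.symm
    have hTe : T = {col p, col q, col r} := by
      refine Finset.eq_of_subset_of_card_le ?_ (by rw [hT]; exact Finset.card_le_three)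
      simpa using hTsub
    have hpq : p ≠ q ∧ p ≠ r ∧ q ≠ r := by simpa [and_assoc] using hnd
    obtain ⟨hpq, hpr, hqr⟩ := hpq
    have nc : NonCrossing c (edge q r) := by
      have : ∀ e ∈ (edge q r).edgeSet, e = s(q, r) := by
        intro e he
        induction e with
        | _ u v => exact Sym2.eq_iff.2 ((edge_adj _ _ _ _).1 he).1
      intro e he f hf hef
      exact absurd ((this e he).trans (this f hf).symm) hef
    have hin : ∀ u v, (edge q r).Adj u v → u ∈ q :: ([] ++ [r]) := by
      intro u v h
      rcases ((edge_adj _ _ _ _).1 h).1 with h | h <;> simp [h.1]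
    refine ⟨edge q r ⊔ edge p q ⊔ edge p r, hmemE hin, nc.sup_ear (m := []) hL hin, ?_⟩
    set K := edge q r ⊔ edge p q ⊔ edge p r
    have a1 : K.Adj p q := Or.inl (Or.inr ((edge_adj _ _ _ _).2 ⟨Or.inl ⟨rfl, rfl⟩, hpq⟩))
    have a2 : K.Adj p r := Or.inr ((edge_adj _ _ _ _).2 ⟨Or.inl ⟨rfl, rfl⟩, hpr⟩)
    have a3 : K.Adj q r := Or.inl (Or.inl ((edge_adj _ _ _ _).2 ⟨Or.inl ⟨rfl, rfl⟩, hqr⟩))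
    intro w hw t ht htw
    rw [hTe] at ht
    simp only [Finset.mem_insert, Finset.mem_singleton] at ht
    simp only [List.mem_cons, List.not_mem_nil, or_false] at hw
    rcases hw with rfl | rfl | rfl <;> rcases ht with rfl | rfl | rfl <;>
      first
        | exact absurd rfl htw
        | exact .of_adj a1
        | exact .of_adj a2
        | exact .of_adj a3
        | exact .of_adj a1.symm
        | exact .of_adj a2.symm
        | exact .of_adj a3.symm
  · obtain ⟨p, q, r, m, hrot, ⟨p', hp', hpp'⟩, hear⟩ := exists_ear hT hlen h1 h2
    have hmem : ∀ w, w ∈ L ↔ w ∈ p :: q :: (m ++ [r]) := fun w => hrot.mem_iff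
    have hnd' := hrot.nodup_iff.1 hnd
    have hL' := hL.isRotated hrot
    obtain ⟨K, k1, k2, k3⟩ := ih (q :: (m ++ [r])).length
      (by rw [hrot.perm.length_eq]; simp) (List.nodup_cons.1 hnd').2
      (List.triplewise_cons.1 hL').2 (fun w hw => h1 w ((hmem w).2 (List.mem_cons_of_mem _ hw)))
      (fun t ht => by
        obtain ⟨w, hw, rfl⟩ := h2 t ht
        rcases List.mem_cons.1 ((hmem w).1 hw) with rfl | hw
        · exact ⟨p', hp', hpp'⟩
        · exact ⟨w, hw, rfl⟩) rfl
    refine ⟨K ⊔ edge p q ⊔ edge p r, fun u v huv => (hmem u).2 (hmemE k1 u v huv),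
      k2.sup_ear hL' k1, fun w hw t ht htw => ?_⟩
    have hKle : K ≤ K ⊔ edge p q ⊔ edge p r := le_sup_left.trans le_sup_left
    rcases List.mem_cons.1 ((hmem w).1 hw) with rfl | hw'
    · have hpn := (List.nodup_cons.1 hnd').1
      have a1 : (K ⊔ edge w q ⊔ edge w r).Adj w q :=
        Or.inl (Or.inr ((edge_adj _ _ _ _).2 ⟨Or.inl ⟨rfl, rfl⟩, fun h => hpn (by simp [h])⟩))
      have a2 : (K ⊔ edge w q ⊔ edge w r).Adj w r :=
        Or.inr ((edge_adj _ _ _ _).2 ⟨Or.inl ⟨rfl, rfl⟩, fun h => hpn (by simp [h])⟩)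
      by_cases hq : col q = col w
      · exact .head a1 hq.symm ((k3 q (by simp) t ht (by rwa [hq])).mono hKle)
      by_cases hr : col r = col w
      · exact .head a2 hr.symm ((k3 r (by simp) t ht (by rwa [hr])).mono hKle)
      have hqr : col q ≠ col r := (hear.resolve_left hq).resolve_left hr
      have hTe : ({col w, col q, col r} : Finset γ) = T := by
        refine Finset.eq_of_subset_of_card_le ?_ ?_
        · simp only [Finset.insert_subset_iff, Finset.singleton_subset_iff]
          exact ⟨h1 w hw, h1 q ((hmem q).2 (by simp)), h1 r ((hmem r).2 (by simp))⟩
        · rw [hT, Finset.card_eq_three.2 ⟨_, _, _, Ne.symm hq, Ne.symm hr, hqr, rfl⟩]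
      rw [← hTe] at ht
      simp only [Finset.mem_insert, Finset.mem_singleton] at ht
      rcases ht with rfl | rfl | rfl
      · exact absurd rfl htw
      · exact .of_adj a1
      · exact .of_adj a2
    · exact (k3 w hw' t ht htw).mono hKle

end SimpleGraph

/-! ### Emulators under YΔ-transformations -/

namespace SimpleGraph

theorem SeesColor.deleteIncidenceSet {W γ : Type*} {K : SimpleGraph W} {col : W → γ} {w x : W}
    {t : γ} (h : K.SeesColor col w t) (hw : col w ≠ col x) (ht : t ≠ col x) :
    (K.deleteIncidenceSet x).SeesColor col w t := by
  obtain ⟨z, z', h1, h2, rfl⟩ := h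
  have key : Relation.ReflTransGen
      (fun u v => (K.deleteIncidenceSet x).Adj u v ∧ col u = col v) w z ∧ col z = col w := by
    clear h2
    induction h1 with
    | refl => exact ⟨.refl, rfl⟩
    | @tail y y' _ hyy' ih =>
      have hy' : col y' = col w := hyy'.2.symm.trans (ih.2)
      refine ⟨ih.1.tail ⟨deleteIncidenceSet_adj.2 ⟨hyy'.1, ?_, ?_⟩, hyy'.2⟩, hy'⟩
      · rintro rfl; exact hw ih.2.symm
      · rintro rfl; exact hw hy'.symm
  refine ⟨z, z', key.1, deleteIncidenceSet_adj.2 ⟨h2, ?_, ?_⟩, rfl⟩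
  · rintro rfl; exact hw key.2.symm
  · rintro rfl; exact ht rfl

/-- Contracting the monochromatic edges one by one turns a coloured planar graph, in which every
vertex sees the colours adjacent to its own one, into an emulator. -/
theorem planarEmulable_of_seesColor {V : Type*} {G : SimpleGraph V} {W : Type} [Finite W]
    {H : SimpleGraph W} {φ : W → V} (hH : H.IsPlanar) (hφ : Function.Surjective φ)
    (hadj : ∀ a b, H.Adj a b → φ a ≠ φ b → G.Adj (φ a) (φ b))
    (hsees : ∀ w t, G.Adj (φ w) t → H.SeesColor φ w t) : G.PlanarEmulable := by
  classical
  induction hn : Nat.card W using Nat.strong_induction_on generalizing W with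
  | _ n ih =>
  subst hn
  by_cases hmono : ∃ u v, H.Adj u v ∧ φ u = φ v
  · obtain ⟨u, v, huv, huvφ⟩ := hmono
    have hvu : v ≠ u := huv.ne'
    let H₁ : SimpleGraph W :=
      { Adj := fun a b => a ≠ b ∧ ((H.Adj a b ∧ a ≠ u ∧ b ≠ u) ∨ (a = v ∧ H.Adj u b) ∨
          (b = v ∧ H.Adj u a))
        symm := ⟨fun a b h => ⟨h.1.symm, h.2.imp (fun h => ⟨h.1.symm, h.2.2, h.2.1⟩) Or.symm⟩⟩
        loopless := ⟨fun a h => h.1 rfl⟩ }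
    have hH₁ : H₁.IsPlanar := hH.contract huv fun a b h => h.2
    -- the contraction map
    let κ : W → {y : W // y ≠ u} := fun y => if h : y = u then ⟨v, hvu⟩ else ⟨y, h⟩
    have hκu : κ u = ⟨v, hvu⟩ := dif_pos rfl
    have hκ : ∀ y (h : y ≠ u), κ y = ⟨y, h⟩ := fun y h => dif_neg h
    let φ₁ : {y : W // y ≠ u} → V := fun y => φ y
    have hφκ : ∀ y, φ₁ (κ y) = φ y := by
      intro y
      by_cases h : y = u
      · rw [h, hκu]; exact huvφ.symm
      · rw [hκ y h]
    have hκadj : ∀ a b, H.Adj a b → κ a = κ b ∨ (H₁.comap Subtype.val).Adj (κ a) (κ b) := by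
      intro a b hab
      by_cases ha : a = u
      · subst ha
        rw [hκu, hκ b hab.ne']
        by_cases hb : v = b
        · exact Or.inl (Subtype.ext hb)
        · exact Or.inr ⟨hb, Or.inr (Or.inl ⟨rfl, hab⟩)⟩
      · by_cases hb : b = u
        · subst hb
          rw [hκu, hκ a ha]
          by_cases ha' : a = v
          · exact Or.inl (Subtype.ext ha')
          · exact Or.inr ⟨ha', Or.inr (Or.inr ⟨rfl, hab.symm⟩)⟩
        · rw [hκ a ha, hκ b hb]
          exact Or.inr ⟨hab.ne, Or.inl ⟨hab, ha, hb⟩⟩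
    refine ih (Nat.card {y : W // y ≠ u}) ?_ (W := {y : W // y ≠ u}) (φ := φ₁)
      (hH₁.comap Subtype.val_injective) ?_ ?_ ?_ rfl
    · exact Finite.card_subtype_lt (x := u) (by simp)
    · intro t
      obtain ⟨y, rfl⟩ := hφ t
      exact ⟨κ y, hφκ y⟩
    · rintro ⟨a, ha⟩ ⟨b, hb⟩ ⟨-, ⟨h, -⟩ | ⟨h, h'⟩ | ⟨h, h'⟩⟩ hab
      · exact hadj a b h hab
      · change φ a ≠ φ b at hab
        change a = v at h
        change G.Adj (φ a) (φ b)
        rw [h, ← huvφ] at hab ⊢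
        exact hadj u b h' hab
      · change φ a ≠ φ b at hab
        change b = v at h
        change G.Adj (φ a) (φ b)
        rw [h, ← huvφ] at hab ⊢
        exact (hadj u a h' hab.symm).symm
    · rintro ⟨w, hw⟩ t ht
      obtain ⟨z, z', h1, h2, rfl⟩ := hsees w t ht
      refine ⟨κ z, κ z', ?_, ?_, hφκ z'⟩
      · rw [← hκ w hw]
        refine Relation.ReflTransGen.lift' κ (fun a b hab => ?_) _ _ h1
        rcases hκadj a b hab.1 with h | h
        · change Relation.ReflTransGen _ (κ a) (κ b)
          rw [h]
        · exact .single ⟨h, by rw [hφκ, hφκ, hab.2]⟩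
      · refine (hκadj z z' h2).resolve_left fun h => ?_
        have hz : φ z = φ w := by
          clear h2 h
          induction h1 with
          | refl => rfl
          | tail _ hab ih => exact hab.2.symm.trans ih
        have := congrArg φ₁ h
        rw [hφκ, hφκ, hz] at this
        exact ht.ne this
  · have hne : ∀ a b, H.Adj a b → φ a ≠ φ b := fun a b h h' => hmono ⟨a, b, h, h'⟩
    refine ⟨W, inferInstance, H, hH, ⟨φ, fun {a b} h => hadj a b h (hne a b h)⟩, hφ, fun w => ?_⟩
    apply Set.Subset.antisymm
    · rintro _ ⟨y, hy, rfl⟩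
      exact hadj w y hy (hne w y hy)
    · intro t ht
      obtain ⟨z, z', h1, h2, rfl⟩ := hsees w t ht
      have : w = z := by
        rcases h1.cases_head with h | ⟨y, h, -⟩
        · exact h
        · exact absurd h.2 (hne w y h.1)
      subst this
      exact ⟨z', h2, rfl⟩

theorem PlanarEmulable.of_iso {V V' : Type*} {G : SimpleGraph V} {G' : SimpleGraph V'}
    (hG : G.PlanarEmulable) (e : G ≃g G') : G'.PlanarEmulable := by
  obtain ⟨W, hW, H, hH, φ, hφ, hloc⟩ := hG
  refine ⟨W, hW, H, hH, e.toHom.comp φ, e.surjective.comp hφ, fun x => ?_⟩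
  change (fun y => e (φ y)) '' H.neighborSet x = G'.neighborSet (e (φ x))
  rw [← Set.image_image e φ, hloc]
  ext t
  constructor
  · rintro ⟨s, hs, rfl⟩
    exact e.map_adj_iff.2 hs
  · intro ht
    refine ⟨e.symm t, ?_, e.apply_symm_apply t⟩
    rw [mem_neighborSet, ← e.map_adj_iff, e.apply_symm_apply]
    exact ht

/-- All vertices over `v` in an emulator of `G` are replaced by chords between their neighbours.
Afterwards, each monochromatic component over a neighbour of `v` sees the other two ones. -/
theorem PlanarEmulable.yDelta {V : Type*} {G : SimpleGraph V} (hG : G.PlanarEmulable) (v : V)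
    (hv : (G.neighborSet v).ncard = 3) : (G.yDelta v).PlanarEmulable := by
  classical
  obtain ⟨W, hW, H, hH, φ, hφ, hloc⟩ := hG
  have := Fintype.ofFinite W
  have hfin : (G.neighborSet v).Finite := Set.finite_of_ncard_ne_zero (by omega)
  obtain ⟨T, hTc, hT⟩ : ∃ T : Finset V, T.card = 3 ∧ ∀ t, t ∈ T ↔ G.Adj v t :=
    ⟨hfin.toFinset, by rw [← Set.ncard_eq_toFinset_card _ hfin, hv], fun t => by simp⟩
  have hvT : v ∉ T := fun h => G.irrefl ((hT v).1 h)
  have hex : ∀ x t, G.Adj (φ x) t → ∃ y, H.Adj x y ∧ φ y = t := by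
    intro x t ht
    have : t ∈ φ '' H.neighborSet x := by rw [hloc]; exact ht
    exact this
  -- `S` is the set of vertices over `v` that have already been replaced
  have key : ∀ S : Finset W, (∀ x ∈ S, φ x = v) → ∃ K : SimpleGraph W, K.IsPlanar ∧
      (∀ a b, K.Adj a b → (H.Adj a b ∧ a ∉ S ∧ b ∉ S) ∨ (φ a ∈ T ∧ φ b ∈ T)) ∧
      (∀ a b, H.Adj a b → a ∉ S → b ∉ S → K.Adj a b) ∧
      ∀ x ∈ S, ∀ w, H.Adj x w → ∀ t ∈ T, t ≠ φ w → K.SeesColor φ w t := by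
    intro S
    induction S using Finset.induction_on with
    | empty => exact fun _ => ⟨H, hH, fun a b h => Or.inl ⟨h, by simp, by simp⟩,
        fun a b h _ _ => h, by simp⟩
    | insert x S hxS ih =>
      intro hS
      obtain ⟨K₁, p1, p2, p3, p4⟩ := ih fun y hy => hS y (Finset.mem_insert_of_mem hy)
      have hxv : φ x = v := hS x (Finset.mem_insert_self _ _)
      have hφT : ∀ w, H.Adj x w → φ w ∈ T := fun w hw => (hT _).2 (hxv ▸ φ.map_adj hw)
      have hN : ∀ w, K₁.Adj x w ↔ H.Adj x w := by
        intro w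
        constructor
        · intro h
          exact ((p2 x w h).resolve_right fun h' => hvT (hxv ▸ h'.1)).1
        · intro h
          refine p3 x w h hxS fun hw => hvT ?_
          have := hφT w h
          rwa [hS w (Finset.mem_insert_of_mem hw)] at this
      obtain ⟨o, r, c, hc, hcr, hK⟩ := p1.exists_circle x
      obtain ⟨L, hnd, hmem, hL⟩ := exists_isConvexPolygon hc
        (Finset.univ.filter fun w => K₁.Adj x w) (o := o) (ρ := r)
        (fun w hw => hcr w (by simpa using hw))
      replace hmem : ∀ w, w ∈ L ↔ H.Adj x w := fun w => by
        rw [hmem, Finset.mem_filter, hN]; simp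
      obtain ⟨K₂, q1, q2, q3⟩ := exists_noncrossing_chords (col := φ) hTc hnd hL
        (fun w hw => hφT w ((hmem w).1 hw))
        (fun t ht => by
          obtain ⟨y, hy, hyt⟩ := hex x t (by rw [hxv]; exact (hT t).1 ht)
          exact ⟨y, (hmem y).2 hy, hyt⟩)
      refine ⟨K₁.deleteIncidenceSet x ⊔ K₂,
        hK K₂ (fun u w h => (hN u).2 ((hmem u).1 (q1 u w h))) q2, ?_, ?_, ?_⟩
      · rintro a b (h | h)
        · rw [deleteIncidenceSet_adj] at h
          refine (p2 a b h.1).imp_left fun h' => ⟨h'.1, ?_, ?_⟩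
          · simp [h.2.1, h'.2.1]
          · simp [h.2.2, h'.2.2]
        · exact Or.inr ⟨hφT a ((hmem a).1 (q1 a b h)), hφT b ((hmem b).1 (q1 b a h.symm))⟩
      · intro a b h ha hb
        rw [Finset.mem_insert, not_or] at ha hb
        exact Or.inl (deleteIncidenceSet_adj.2 ⟨p3 a b h ha.2 hb.2, ha.1, hb.1⟩)
      · intro y hy w hyw t ht htw
        rcases Finset.mem_insert.1 hy with rfl | hy'
        · exact (q3 w ((hmem w).2 hyw) t ht htw).mono le_sup_right
        · refine ((p4 y hy' w hyw t ht htw).deleteIncidenceSet ?_ ?_).mono le_sup_left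
          · rw [hxv, ← hS y hy]
            exact (φ.map_adj hyw).ne'
          · rw [hxv]
            rintro rfl
            exact hvT ht
  obtain ⟨K, p1, p2, p3, p4⟩ := key (Finset.univ.filter fun x => φ x = v) (by simp)
  simp only [Finset.mem_filter, Finset.mem_univ, true_and] at p2 p3 p4
  refine planarEmulable_of_seesColor (W := {x : W // φ x ≠ v}) (H := K.comap Subtype.val)
    (φ := fun x => ⟨φ x, x.2⟩) (p1.comap Subtype.val_injective) ?_ ?_ ?_
  · rintro ⟨t, ht⟩
    obtain ⟨x, rfl⟩ := hφ t
    exact ⟨⟨x, ht⟩, rfl⟩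
  · rintro ⟨a, ha⟩ ⟨b, hb⟩ hab hne
    refine ⟨hne, (p2 a b hab).imp (fun h => φ.map_adj h.1) fun h => ⟨?_, ?_⟩⟩
    · exact (hT _).1 h.1
    · exact (hT _).1 h.2
  · rintro ⟨w, hw⟩ ⟨t, ht⟩ ⟨hwt, hadj⟩
    have hwt' : φ w ≠ t := fun h => hwt (Subtype.ext h)
    have hsee : K.SeesColor φ w t := by
      rcases hadj with h | ⟨h, h'⟩
      · obtain ⟨y, hy, rfl⟩ := hex w t h
        exact .of_adj (p3 w y hy hw ht)
      · obtain ⟨x, hx, hxv⟩ := hex w v h.symm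
        exact p4 x hxv w hx.symm t ((hT t).2 h') hwt'.symm
    obtain ⟨z, z', h1, h2, rfl⟩ := hsee
    have hpath : ∃ hz : φ z ≠ v, Relation.ReflTransGen
        (fun a b : {x : W // φ x ≠ v} => (K.comap Subtype.val).Adj a b ∧
          (⟨φ a, a.2⟩ : {x // x ≠ v}) = ⟨φ b, b.2⟩) ⟨w, hw⟩ ⟨z, hz⟩ := by
      clear h2
      induction h1 with
      | refl => exact ⟨hw, .refl⟩
      | @tail y y' _ hyy' ih =>
        obtain ⟨hy, hp⟩ := ih
        exact ⟨hyy'.2 ▸ hy, hp.tail ⟨hyy'.1, Subtype.ext hyy'.2⟩⟩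
    obtain ⟨hz, hpath⟩ := hpath
    exact ⟨⟨z, hz⟩, ⟨z', ht⟩, hpath, h2, rfl⟩

end SimpleGraph

theorem proposition5 {V W : Type u} [Finite V] (G : SimpleGraph V) (G' : SimpleGraph W)
    (hG : G.PlanarEmulable) (hGG' : G.YDeltaReachable G') : G'.PlanarEmulable := by
  induction hGG' with
  | refl => exact hG
  | step _ v hv e ih => exact (ih.yDelta v hv).of_iso e
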